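/- Let $G$ be a finite simple graph that is biconnected, i.e. $G$ has at least two vertices and every two distinct vertices $u,v$ are joined by two distinct paths that share only $u$ and $v$. A planar rectilinear drawing of $G$ places the vertices at distinct points of the plane and draws every edge as a horizontal or vertical segment, so that two distinct edges meet only at common end-vertices. Its faces are the connected components of the complement of the drawing; the unbounded one is the external face, the others are internal. Two such drawings are shape equivalent if they have the same planar embedding (the same faces, described by their boundary vertices and edges, with the same external face, and the same cyclic order of the edges around every vertex) and the same geometric angle between consecutive edges at every vertex. A rectilinear representation $H$ of $G$ is a shape equivalence class of planar rectilinear drawings of $G$; its members are the drawings of $H$. A drawing is greedy if for every ordered pair of vertices $u,v$ there is a path $u=v_0,v_1,\dots,v_k=v$ of $G$ with $d(v_{i+1},v)<d(v_i,v)$ for $0\le i<k$, where $d$ is the Euclidean distance in the drawing. $H$ is greedy realizable if some drawing of $H$ is greedy. If $H$ is greedy realizable, then $H$ is convex, that is, in every drawing of $H$, every internal face is a rectangle and the external face is bounded by an orthoconvex polygon: its boundary is the simple polygon formed by a cycle of $G$, and every horizontal or vertical line meets the closed region enclosed by this polygon either in the empty set or in a single segment. -/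

import Mathlib

open Filter Topology

/-- Biconnectivity: there are at least two vertices, and every two distinct vertices are joined by
two distinct paths that share no vertex other than their ends. -/
def IsBiconnected {V : Type*} (G : SimpleGraph V) : Prop :=
  Nontrivial V ∧ ∀ u v : V, u ≠ v → ∃ p q : G.Walk u v,
    p.IsPath ∧ q.IsPath ∧ p ≠ q ∧ ∀ w, w ∈ p.support → w ∈ q.support → w = u ∨ w = v

/-- A planar rectilinear drawing of `G`. The plane is `ℂ`, with its Euclidean metric and the
coordinates `re` and `im`; the edge `uv` is drawn as the segment from `pos u` to `pos v`. -/
structure RectilinearDrawing {V : Type*} (G : SimpleGraph V) where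
  pos : V → ℂ
  pos_injective : Function.Injective pos
  rectilinear : ∀ u v, G.Adj u v → (pos u).re = (pos v).re ∨ (pos u).im = (pos v).im
  planar : ∀ u v u' v', G.Adj u v → G.Adj u' v' → s(u, v) ≠ s(u', v') →
    ∀ z, z ∈ segment ℝ (pos u) (pos v) → z ∈ segment ℝ (pos u') (pos v') →
      ∃ w, w ∈ s(u, v) ∧ w ∈ s(u', v') ∧ z = pos w

/-- The closed region enclosed by a closed curve `C`: the curve together with the bounded
components of its complement. -/
def closedRegion (C : Set ℂ) : Set ℂ :=
  C ∪ {z | z ∈ Cᶜ ∧ Bornology.IsBounded (connectedComponentIn Cᶜ z)}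

/-- Every vertical and every horizontal line meets `P` in the empty set or in a single segment. -/
def IsOrthoconvex (P : Set ℂ) : Prop :=
  (∀ x : ℝ, P ∩ {z | z.re = x} = ∅ ∨ ∃ a b : ℂ, P ∩ {z | z.re = x} = segment ℝ a b) ∧
  (∀ y : ℝ, P ∩ {z | z.im = y} = ∅ ∨ ∃ a b : ℂ, P ∩ {z | z.im = y} = segment ℝ a b)

namespace RectilinearDrawing

variable {V : Type*} {G : SimpleGraph V}

/-- The point set covered by the drawing. -/
def image (Γ : RectilinearDrawing G) : Set ℂ :=
  Set.range Γ.pos ∪ {z | ∃ u v, G.Adj u v ∧ z ∈ segment ℝ (Γ.pos u) (Γ.pos v)}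

/-- `F` is a face: a connected component of the complement of the drawing. -/
def IsFace (Γ : RectilinearDrawing G) (F : Set ℂ) : Prop :=
  ∃ z ∈ Γ.imageᶜ, F = connectedComponentIn Γ.imageᶜ z

/-- An internal face is a bounded face. -/
def IsInternalFace (Γ : RectilinearDrawing G) (F : Set ℂ) : Prop :=
  Γ.IsFace F ∧ Bornology.IsBounded F

/-- An external face is an unbounded face (there is exactly one when `G` is finite). -/
def IsExternalFace (Γ : RectilinearDrawing G) (F : Set ℂ) : Prop :=
  Γ.IsFace F ∧ ¬ Bornology.IsBounded F

/-- The region `F` lies immediately to the left of the edge `d`, traversed from its first to its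
second end: the points close to the midpoint of `d` on its left-hand side belong to `F`. -/
def LiesLeftOf (Γ : RectilinearDrawing G) (F : Set ℂ) (d : G.Dart) : Prop :=
  ∀ᶠ t : ℝ in 𝓝[>] 0,
    midpoint ℝ (Γ.pos d.fst) (Γ.pos d.snd)
      + (t : ℂ) * (Complex.I * (Γ.pos d.snd - Γ.pos d.fst)) ∈ F

/-- The counterclockwise angle at `v` from the edge `vu` to the edge `vw`, in `(-π, π]`
(so that an angle of 270 degrees is represented by `-π/2`). -/
noncomputable def angle (Γ : RectilinearDrawing G) (u v w : V) : ℝ :=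
  Complex.arg ((Γ.pos w - Γ.pos v) / (Γ.pos u - Γ.pos v))

/-- The two drawings have the same faces, described by the oriented edges on their boundaries
(a face being to the left of its boundary edges), and the same external face. -/
def SameFaces (Γ Γ' : RectilinearDrawing G) : Prop :=
  (∀ d d' : G.Dart,
    (∃ F, Γ.IsFace F ∧ Γ.LiesLeftOf F d ∧ Γ.LiesLeftOf F d') ↔
      (∃ F, Γ'.IsFace F ∧ Γ'.LiesLeftOf F d ∧ Γ'.LiesLeftOf F d')) ∧
  (∀ d : G.Dart,
    (∃ F, Γ.IsExternalFace F ∧ Γ.LiesLeftOf F d) ↔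
      (∃ F, Γ'.IsExternalFace F ∧ Γ'.LiesLeftOf F d))

/-- The oriented angles between the edges at each vertex agree (equivalently, the cyclic orders of
the edges around each vertex agree and so do the angles between consecutive edges). -/
def SameAngles (Γ Γ' : RectilinearDrawing G) : Prop :=
  ∀ u v w : V, G.Adj v u → G.Adj v w → Γ.angle u v w = Γ'.angle u v w

/-- Shape equivalence: the same planar embedding and the same angles. -/
def ShapeEquivalent (Γ Γ' : RectilinearDrawing G) : Prop :=
  Γ.SameFaces Γ' ∧ Γ.SameAngles Γ'

theorem shapeEquivalent_equivalence : Equivalence (ShapeEquivalent (G := G)) where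
  refl _ := ⟨⟨fun _ _ => Iff.rfl, fun _ => Iff.rfl⟩, fun _ _ _ _ _ => rfl⟩
  symm h := ⟨⟨fun d d' => (h.1.1 d d').symm, fun d => (h.1.2 d).symm⟩,
    fun u v w hu hw => (h.2 u v w hu hw).symm⟩
  trans h k := ⟨⟨fun d d' => (h.1.1 d d').trans (k.1.1 d d'),
    fun d => (h.1.2 d).trans (k.1.2 d)⟩,
    fun u v w hu hw => (h.2 u v w hu hw).trans (k.2 u v w hu hw)⟩

/-- A path ending at `v` along which the distance to `v` decreases at every step. -/
def DistanceDecreasing (Γ : RectilinearDrawing G) {u v : V} (p : G.Walk u v) : Prop :=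
  p.IsPath ∧ ∀ i < p.length,
    dist (Γ.pos (p.getVert (i + 1))) (Γ.pos v) < dist (Γ.pos (p.getVert i)) (Γ.pos v)

/-- The drawing is greedy. -/
def IsGreedy (Γ : RectilinearDrawing G) : Prop :=
  ∀ u v : V, ∃ p : G.Walk u v, Γ.DistanceDecreasing p

/-- The closed curve along which the closed walk `c` is drawn. -/
def curve (Γ : RectilinearDrawing G) {v : V} (c : G.Walk v v) : Set ℂ :=
  {z | ∃ a b, s(a, b) ∈ c.edges ∧ z ∈ segment ℝ (Γ.pos a) (Γ.pos b)}

/-- Every internal face is a rectangle. -/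
def InternalFacesRectangular (Γ : RectilinearDrawing G) : Prop :=
  ∀ F, Γ.IsInternalFace F →
    ∃ a b c d : ℝ, a < b ∧ c < d ∧ F = {z | a < z.re ∧ z.re < b ∧ c < z.im ∧ z.im < d}

/-- The external face is bounded by an orthoconvex simple polygon: its boundary is the curve of a
(simple) cycle of `G`, and the polygon enclosed by that curve is orthoconvex. -/
def OuterBoundaryOrthoconvex (Γ : RectilinearDrawing G) : Prop :=
  ∀ F, Γ.IsExternalFace F →
    ∃ (v : V) (c : G.Walk v v), c.IsCycle ∧ frontier F = Γ.curve c ∧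
      IsOrthoconvex (closedRegion (Γ.curve c))

end RectilinearDrawing

/-- Shape equivalence as a setoid. -/
def shapeSetoid {V : Type*} (G : SimpleGraph V) : Setoid (RectilinearDrawing G) where
  r := RectilinearDrawing.ShapeEquivalent
  iseqv := RectilinearDrawing.shapeEquivalent_equivalence

/-- A rectilinear representation of `G`: a shape equivalence class of planar rectilinear drawings. -/
def RectilinearRepresentation {V : Type*} (G : SimpleGraph V) : Type _ :=
  Quotient (shapeSetoid G)

namespace RectilinearRepresentation

variable {V : Type*} {G : SimpleGraph V}

/-- `Γ` is a drawing of the representation `H`, that is, it belongs to the class `H`. -/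
def IsDrawing (H : RectilinearRepresentation G) (Γ : RectilinearDrawing G) : Prop :=
  Quotient.mk (shapeSetoid G) Γ = H

/-- `H` has a greedy drawing. -/
def GreedyRealizable (H : RectilinearRepresentation G) : Prop :=
  ∃ Γ : RectilinearDrawing G, H.IsDrawing Γ ∧ Γ.IsGreedy

/-- `H` is convex: in every drawing of `H` the internal faces are rectangles and the external face
is bounded by an orthoconvex polygon. -/
def IsConvex (H : RectilinearRepresentation G) : Prop :=
  ∀ Γ : RectilinearDrawing G, H.IsDrawing Γ →
    Γ.InternalFacesRectangular ∧ Γ.OuterBoundaryOrthoconvex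

end RectilinearRepresentation

/-! In a greedy drawing every vertex has a neighbour closer to any prescribed target. If no
neighbour of `v` lies to the right of or above `v` (an upper right corner), no neighbour of `v` is
closer than `v` to a vertex of the closed quadrant beyond `v`, so that quadrant contains no other
vertex. A drawing with this property in all four directions is called tidy
(`IsGrid.isTidy_of_closer`).

Tidiness depends only on the directions of the edges. In a tidy drawing two successive corners are
joined by a leftward chain followed by an upward one (`IsTidy.exists_step`), so in every drawing
with the same edge directions the corners climb strictly to the left. As every vertex is dominated
by a corner, the quadrants beyond the corners remain empty (`IsTidy.of_lt_iff`). Equal angles in a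
connected graph fix the edge directions up to one common rotation
(`RectilinearDrawing.SameAngles.exists_rotation`), hence every drawing of a greedy realizable
representation is tidy.

A tidy drawing of a biconnected graph is convex. The orthogonal hull of the vertices is bounded by
four monotone staircases, which are drawn by the chains above. A vertex on two opposite staircases
would be a cut vertex, so the staircases close up to a simple cycle (`IsTidy.exists_isCycle`).
Inside the hull, consider a maximal empty box bounded by vertex coordinates. A side carrying no
drawn point could be pushed outwards, and a drawn stretch of a side could end early only at a
corner, beyond which the hull provides another vertex. So all sides are drawn (`IsTidy.exists_box`),
and every internal face is such a box.

Coordinates are kept as two functions `x y : V → ℝ`, so that the four directions are exchanged by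
swapping and negating them. -/

section

/-! ### Grids, corners and tidiness. -/

variable {V : Type*} {G : SimpleGraph V} {x y : V → ℝ}

/-- The point `(a, b)` lies in the box spanned by the vertices `u` and `v`; if `uv` is drawn
parallel to an axis, this box is the segment from `u` to `v`. -/
def InBox (x y : V → ℝ) (u v : V) (a b : ℝ) : Prop :=
  a ∈ Set.uIcc (x u) (x v) ∧ b ∈ Set.uIcc (y u) (y v)

theorem InBox.symm {u v : V} {a b : ℝ} (h : InBox x y u v a b) : InBox x y v u a b := by
  rwa [InBox, Set.uIcc_comm (x v), Set.uIcc_comm (y v)]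

theorem InBox.swap {u v : V} {a b : ℝ} (h : InBox x y u v a b) : InBox y x u v b a := And.symm h

theorem InBox.negX {u v : V} {a b : ℝ} (h : InBox x y u v a b) : InBox (-x) y u v (-a) b := by
  refine ⟨?_, h.2⟩
  have := h.1
  simp only [Set.mem_uIcc, Pi.neg_apply] at this ⊢
  grind

/-- The coordinates of a planar rectilinear drawing of a graph in which every vertex has two
neighbours. -/
structure IsGrid (G : SimpleGraph V) (x y : V → ℝ) : Prop where
  injective : ∀ u v, x u = x v → y u = y v → u = v
  rectilinear : ∀ u v, G.Adj u v → x u = x v ∨ y u = y v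
  planar : ∀ u v u' v', G.Adj u v → G.Adj u' v' → s(u, v) ≠ s(u', v') → ∀ a b,
    InBox x y u v a b → InBox x y u' v' a b → ∃ w, w ∈ s(u, v) ∧ w ∈ s(u', v') ∧ a = x w ∧ b = y w
  two_neighbors : ∀ v, ∃ u w, u ≠ w ∧ G.Adj v u ∧ G.Adj v w

namespace IsGrid

theorem swap (h : IsGrid G x y) : IsGrid G y x where
  injective u v hx hy := h.injective u v hy hx
  rectilinear u v huv := (h.rectilinear u v huv).symm
  planar u v u' v' huv huv' hne a b hab hab' := by
    obtain ⟨w, h1, h2, h3, h4⟩ := h.planar u v u' v' huv huv' hne b a hab.swap hab'.swap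
    exact ⟨w, h1, h2, h4, h3⟩
  two_neighbors := h.two_neighbors

theorem negX (h : IsGrid G x y) : IsGrid G (-x) y where
  injective u v hx hy := h.injective u v (neg_injective hx) hy
  rectilinear u v huv := by simpa using h.rectilinear u v huv
  planar u v u' v' huv huv' hne a b hab hab' := by
    have h1 := hab.negX
    have h2 := hab'.negX
    rw [neg_neg] at h1 h2
    obtain ⟨w, h1, h2, h3, h4⟩ := h.planar u v u' v' huv huv' hne (-a) b h1 h2
    exact ⟨w, h1, h2, by simp [← h3], h4⟩
  two_neighbors := h.two_neighbors

theorem eq_or_eq_of_inBox (h : IsGrid G x y) {u v w : V} (huv : G.Adj u v)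
    (hw : InBox x y u v (x w) (y w)) : w = u ∨ w = v := by
  by_contra! hne
  obtain ⟨t, -, -, hwt, -⟩ := h.two_neighbors w
  have hs : s(u, v) ≠ s(w, t) := by
    intro he
    have : w ∈ s(u, v) := he ▸ Sym2.mem_mk_left w t
    rw [Sym2.mem_iff] at this
    tauto
  obtain ⟨z, hz, -, hzx, hzy⟩ := h.planar u v w t huv hwt hs _ _ hw
    ⟨Set.left_mem_uIcc, Set.left_mem_uIcc⟩
  rw [← h.injective w z hzx hzy, Sym2.mem_iff] at hz
  tauto

end IsGrid

/-- No neighbour of `v` lies to the right of or above `v`. -/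
def IsNECorner (G : SimpleGraph V) (x y : V → ℝ) (v : V) : Prop :=
  ∀ u, G.Adj v u → x u ≤ x v ∧ y u ≤ y v

theorem IsNECorner.swap {v : V} (h : IsNECorner G x y v) : IsNECorner G y x v :=
  fun u hu => (h u hu).symm

/-- The closed quadrant beyond a corner contains no further vertex. -/
def CornersFree (G : SimpleGraph V) (x y : V → ℝ) : Prop :=
  ∀ v w, IsNECorner G x y v → x v ≤ x w → y v ≤ y w → w = v

theorem CornersFree.swap (h : CornersFree G x y) : CornersFree G y x :=
  fun v w hv hy hx => h v w hv.swap hx hy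

/-- A grid in which the quadrants beyond the corners of all four directions are free of
vertices. -/
structure IsTidy (G : SimpleGraph V) (x y : V → ℝ) : Prop extends IsGrid G x y where
  ne : CornersFree G x y
  nw : CornersFree G (-x) y
  se : CornersFree G x (-y)
  sw : CornersFree G (-x) (-y)

namespace IsTidy

theorem swap (h : IsTidy G x y) : IsTidy G y x where
  toIsGrid := h.toIsGrid.swap
  ne := h.ne.swap
  nw := h.se.swap
  se := h.nw.swap
  sw := h.sw.swap

theorem negX (h : IsTidy G x y) : IsTidy G (-x) y where
  toIsGrid := h.toIsGrid.negX
  ne := h.nw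
  nw := by simpa using h.ne
  se := h.sw
  sw := by simpa using h.se

theorem negY (h : IsTidy G x y) : IsTidy G x (-y) := h.swap.negX.swap

theorem rotate (h : IsTidy G x y) : IsTidy G y (-x) := h.negX.swap

end IsTidy

/-- Every step of the walk goes to the right. -/
def Rightward (x y : V → ℝ) {u v : V} (p : G.Walk u v) : Prop :=
  ∀ d ∈ p.darts, x d.fst < x d.snd ∧ y d.fst = y d.snd

theorem Rightward.of_imp {x' y' : V → ℝ} {u v : V} {p : G.Walk u v} (hp : Rightward x y p)
    (hx : ∀ u v, G.Adj u v → x u < x v → x' u < x' v)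
    (hy : ∀ u v, G.Adj u v → y u = y v → y' u = y' v) :
    Rightward x' y' p :=
  fun d hd => ⟨hx _ _ d.adj (hp d hd).1, hy _ _ d.adj (hp d hd).2⟩

theorem Rightward.y_eq {u v : V} {p : G.Walk u v} (hp : Rightward x y p) : y u = y v := by
  induction p with
  | nil => rfl
  | cons hadj p ih =>
    simp only [Rightward, SimpleGraph.Walk.darts_cons, List.mem_cons, forall_eq_or_imp] at hp
    exact hp.1.2.trans (ih hp.2)

theorem Rightward.x_le {u v : V} {p : G.Walk u v} (hp : Rightward x y p) : x u ≤ x v := by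
  induction p with
  | nil => rfl
  | cons hadj p ih =>
    simp only [Rightward, SimpleGraph.Walk.darts_cons, List.mem_cons, forall_eq_or_imp] at hp
    exact hp.1.1.le.trans (ih hp.2)

theorem Rightward.x_lt {u v : V} {p : G.Walk u v} (hp : Rightward x y p) (hne : u ≠ v) :
    x u < x v := by
  cases p with
  | nil => exact absurd rfl hne
  | cons hadj p =>
    simp only [Rightward, SimpleGraph.Walk.darts_cons, List.mem_cons, forall_eq_or_imp] at hp
    exact hp.1.1.trans_le (Rightward.x_le (y := y) hp.2)

variable {x' y' : V → ℝ}

theorem IsNECorner.of_lt_iff {v : V} (hv : IsNECorner G x y v)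
    (hx : ∀ u v, G.Adj u v → (x u < x v ↔ x' u < x' v))
    (hy : ∀ u v, G.Adj u v → (y u < y v ↔ y' u < y' v)) : IsNECorner G x' y' v := by
  intro u hu
  have h1 := hv u hu
  rw [← not_lt, ← not_lt] at h1 ⊢
  rwa [← hx v u hu, ← hy v u hu]

/-- A drawing whose vertices all have a neighbour closer to any given target is tidy. -/
theorem IsGrid.isTidy_of_closer (h : IsGrid G x y)
    (hcl : ∀ v w, v ≠ w → ∃ u, G.Adj v u ∧
      (x u - x w) ^ 2 + (y u - y w) ^ 2 < (x v - x w) ^ 2 + (y v - y w) ^ 2) : IsTidy G x y := by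
  have key : ∀ x y : V → ℝ, (∀ v w, v ≠ w → ∃ u, G.Adj v u ∧
      (x u - x w) ^ 2 + (y u - y w) ^ 2 < (x v - x w) ^ 2 + (y v - y w) ^ 2) →
      CornersFree G x y := by
    intro x y hcl v w hv hx hy
    by_contra hne
    obtain ⟨u, hu, hlt⟩ := hcl v w (Ne.symm hne)
    obtain ⟨hux, huy⟩ := hv u hu
    nlinarith [mul_nonneg (sub_nonneg.2 hux) (sub_nonneg.2 hx),
      mul_nonneg (sub_nonneg.2 huy) (sub_nonneg.2 hy), sq_nonneg (x v - x u),
      sq_nonneg (y v - y u)]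
  have e1 : ∀ a b : ℝ, (-a + b) ^ 2 = (a - b) ^ 2 := fun a b => by ring
  exact { toIsGrid := h
          ne := key _ _ hcl
          nw := key _ _ (by simpa [e1] using hcl)
          se := key _ _ (by simpa [e1] using hcl)
          sw := key _ _ (by simpa [e1] using hcl) }

/-! ### Chains between successive corners; tidiness and edge directions. -/

section Finite

variable [Finite V]

/-- A vertex of the closed quadrant at `v` maximizing `x + y` is a corner: an edge to the right or
upwards stays in the quadrant and increases the sum. -/
theorem IsGrid.exists_corner_ge (h : IsGrid G x y) (v : V) :
    ∃ m, IsNECorner G x y m ∧ x v ≤ x m ∧ y v ≤ y m := by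
  obtain ⟨m, ⟨hmx, hmy⟩, hm⟩ := Set.exists_max_image {m | x v ≤ x m ∧ y v ≤ y m}
    (fun m => x m + y m) (Set.toFinite _) ⟨v, le_rfl, le_rfl⟩
  refine ⟨m, fun u hu => ?_, hmx, hmy⟩
  by_contra hcon
  rcases h.rectilinear m u hu with he | he
  · have := hm u ⟨by linarith, by grind⟩
    grind
  · have := hm u ⟨by grind, by linarith⟩
    grind

/-- From `m` one can walk to the left as far as possible without passing the abscissa `a`. -/
theorem exists_leftward_walk (G : SimpleGraph V) (x y : V → ℝ) {m : V} {a : ℝ} (ha : a ≤ x m) :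
    ∃ p, ∃ w : G.Walk m p, Rightward (-x) y w ∧ a ≤ x p ∧ x p ≤ x m ∧ y p = y m ∧
      ∀ u, G.Adj p u → y u = y p → x u < x p → x u < a := by
  obtain ⟨p, ⟨⟨w, hw⟩, hap, hpm, hy⟩, hp⟩ := Set.exists_min_image
    {p | (∃ w : G.Walk m p, Rightward (-x) y w) ∧ a ≤ x p ∧ x p ≤ x m ∧ y p = y m} x
    (Set.toFinite _) ⟨m, ⟨.nil, by simp [Rightward]⟩, ha, le_rfl, rfl⟩
  refine ⟨p, w, hw, hap, hpm, hy, fun u hu hyu hxu => ?_⟩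
  by_contra! hau
  refine absurd (hp u ⟨⟨w.concat hu, ?_⟩, hau, by linarith, by linarith⟩) (by linarith)
  intro d hd
  rw [SimpleGraph.Walk.darts_concat, List.concat_eq_append, List.mem_append,
    List.mem_singleton] at hd
  rcases hd with hd | rfl
  · exact hw d hd
  · exact ⟨by simpa using hxu, hyu.symm⟩

/-- A corner dominating a higher `w` would be to the right of `n`, hence not to the left of `m`, and
above `m`: it would lie in the quadrant beyond `m`. -/
theorem IsTidy.le_of_successive (h : IsTidy G x y) {m n : V} (hm : IsNECorner G x y m)
    (hcons : ∀ k, IsNECorner G x y k → x n < x k → x m ≤ x k) (w : V) (hw : x n < x w) :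
    y w ≤ y m := by
  by_contra! hyw
  obtain ⟨k, hk, hxk, hyk⟩ := h.exists_corner_ge w
  have := h.ne m k hm (hcons k hk (by linarith)) (by linarith)
  rw [this] at hyk
  linarith

/-- Two successive corners `m` and `n` are joined by a straight chain to the left followed by a
straight chain upwards (listed here from `n` downwards). -/
theorem IsTidy.exists_step (h : IsTidy G x y) {m n : V} (hm : IsNECorner G x y m)
    (hn : IsNECorner G x y n) (hlt : x n < x m)
    (hcons : ∀ k, IsNECorner G x y k → x n < x k → x m ≤ x k) :
    ∃ c, ∃ p : G.Walk m c, ∃ q : G.Walk n c,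
      Rightward (-x) y p ∧ Rightward (-y) x q ∧ x c = x n ∧ y c = y m := by
  have hylt : y m < y n := by
    by_contra! hle
    have := h.ne n m hn hlt.le hle
    rw [this] at hlt
    exact lt_irrefl _ hlt
  have free := h.le_of_successive hm hcons
  obtain ⟨p, w, hw, hap, hpm, hpy, hp⟩ := exists_leftward_walk G x y hlt.le
  obtain ⟨q, w', hw', haq, hqn, hqx, hq⟩ := exists_leftward_walk G y x hylt.le
  -- If the leftward walk stopped short of `x n` and no edge leapt over that abscissa, `p` would be
  -- an upper left corner, since `free` excludes edges going up from it. But `n` lies in the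
  -- quadrant beyond `p`. The downward walk is treated likewise, with a lower right corner `q` and
  -- `m` beyond it.
  have hp' : x p = x n ∨ ∃ u, G.Adj p u ∧ y u = y p ∧ x u < x n := by
    by_contra! hcon
    have hlt' : x n < x p := lt_of_le_of_ne hap (Ne.symm hcon.1)
    have hcor : IsNECorner G (-x) y p := by
      intro u hu
      simp only [Pi.neg_apply, neg_le_neg_iff]
      have h1 := hp u hu
      have h2 := hcon.2 u hu
      rcases h.rectilinear p u hu with he | he
      · exact ⟨he.le, by rw [hpy]; exact free u (by linarith)⟩
      · refine ⟨?_, he.symm.le⟩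
        by_contra! hlt
        linarith [h1 he.symm hlt, h2 he.symm]
    have := h.nw p n hcor (by simpa using hap) (by linarith)
    rw [this] at hlt'
    exact lt_irrefl _ hlt'
  have hq' : y q = y m ∨ ∃ u, G.Adj q u ∧ x u = x q ∧ y u < y m := by
    by_contra! hcon
    have hlt' : y m < y q := lt_of_le_of_ne haq (Ne.symm hcon.1)
    have hcor : IsNECorner G x (-y) q := by
      intro u hu
      simp only [Pi.neg_apply, neg_le_neg_iff]
      have h1 := hq u hu
      have h2 := hcon.2 u hu
      rcases h.rectilinear q u hu with he | he
      · refine ⟨he.symm.le, ?_⟩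
        by_contra! hlt
        linarith [h1 he.symm hlt, h2 he.symm]
      · refine ⟨?_, he.le⟩
        by_contra! hlt
        linarith [free u (by linarith)]
    have := h.se q m hcor (by rw [hqx]; exact hlt.le) (by simpa using hlt'.le)
    rw [this] at hlt'
    exact lt_irrefl _ hlt'
  -- Both chains, each prolonged by its leaping edge if there is one, pass through `(x n, y m)`.
  -- Planarity forces them to meet there in a common vertex, so neither edge leaps.
  suffices hpq : p = q by
    subst hpq
    exact ⟨p, w, w', hw, hw', hqx, hpy⟩
  rcases hp' with hp' | ⟨u, hu, huy, hux⟩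
  · rcases hq' with hq' | ⟨v, hv, hvx, hvy⟩
    · exact h.injective _ _ (by linarith) (by linarith)
    · rcases h.eq_or_eq_of_inBox (w := p) hv ⟨by rw [hvx, hqx, hp']; simp,
        by rw [Set.mem_uIcc]; right; constructor <;> linarith⟩ with he | he
      · exact he
      · rw [he] at hpy; linarith
  · rcases hq' with hq' | ⟨v, hv, hvx, hvy⟩
    · rcases h.eq_or_eq_of_inBox (w := q) hu ⟨by rw [Set.mem_uIcc]; right; constructor <;> linarith,
        by rw [huy, hpy, hq']; simp⟩ with he | he
      · exact he.symm
      · rw [he] at hqx; linarith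
    · have hne : s(p, u) ≠ s(q, v) := by
        intro he
        have h1 : u ∈ s(q, v) := he ▸ Sym2.mem_mk_right p u
        rw [Sym2.mem_iff] at h1
        rcases h1 with rfl | rfl <;> linarith
      obtain ⟨z, hz, hz', hzx, hzy⟩ := h.planar p u q v hu hv hne (x n) (y m)
        ⟨by rw [Set.mem_uIcc]; right; constructor <;> linarith, by rw [huy, hpy]; simp⟩
        ⟨by rw [hvx, hqx]; simp, by rw [Set.mem_uIcc]; right; constructor <;> linarith⟩
      rw [Sym2.mem_iff] at hz hz'
      rcases hz with rfl | rfl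
      · rcases hz' with rfl | rfl
        · rfl
        · linarith
      · linarith

/-- Induction over the corners, from a corner `r` to the left. -/
theorem IsTidy.corner_induction (h : IsTidy G x y) {r : V} {P : V → Prop}
    (hr : IsNECorner G x y r) (h0 : P r)
    (hstep : ∀ m n, IsNECorner G x y m → IsNECorner G x y n → x n < x m →
      (∀ k, IsNECorner G x y k → x n < x k → x m ≤ x k) → P m → P n)
    (n : V) (hn : IsNECorner G x y n) (hlt : x n < x r) : P n := by
  have hwf : WellFounded (fun u v : V => x v < x u) :=
    haveI : IsTrans V (fun u v => x v < x u) := ⟨fun a b c h1 h2 => lt_trans h2 h1⟩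
    haveI : Std.Irrefl (fun u v : V => x v < x u) := ⟨fun a => lt_irrefl _⟩
    Finite.wellFounded_of_trans_of_irrefl _
  induction n using hwf.induction with
  | _ n ih =>
    obtain ⟨m, ⟨hm, hnm⟩, hmin⟩ := Set.exists_min_image {m | IsNECorner G x y m ∧ x n < x m} x
      (Set.toFinite _) ⟨r, hr, hlt⟩
    refine hstep m n hm hn hnm (fun k hk hk' => hmin k ⟨hk, hk'⟩) ?_
    -- If `m` has the abscissa of `r`, then `m = r`: of two corners on a vertical line the higher
    -- lies in the quadrant beyond the lower.
    rcases (hmin r ⟨hr, hlt⟩).lt_or_eq with hmr | hmr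
    · exact ih m hnm hm hmr
    · rcases le_total (y m) (y r) with hy | hy
      · rwa [← h.ne m r hm hmr.le hy]
      · rwa [h.ne r m hr hmr.ge hy]

/-- The corners form an antichain in every grid in which the edges have the same directions. -/
theorem IsTidy.corners_antichain (h : IsTidy G x y)
    (hx : ∀ u v, G.Adj u v → (x u < x v ↔ x' u < x' v))
    (hy : ∀ u v, G.Adj u v → (y u < y v ↔ y' u < y' v)) {r n : V}
    (hr : IsNECorner G x y r) (hn : IsNECorner G x y n) (hlt : x n < x r) :
    x' n < x' r ∧ y' r < y' n := by
  have hxe : ∀ u v, G.Adj u v → x u = x v → x' u = x' v := fun u v huv he => by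
    have h1 := hx u v huv
    have h2 := hx v u huv.symm
    grind
  have hye : ∀ u v, G.Adj u v → y u = y v → y' u = y' v := fun u v huv he => by
    have h1 := hy u v huv
    have h2 := hy v u huv.symm
    grind
  have key := h.corner_induction (P := fun n => n = r ∨ (x' n < x' r ∧ y' r < y' n)) hr
    (.inl rfl) (fun m n hm hn hlt hcons hP => ?_) n hn hlt
  · rcases key with rfl | key
    · exact absurd hlt (lt_irrefl _)
    · exact key
  · obtain ⟨c, p, q, hp, hq, hcx, hcy⟩ := h.exists_step hm hn hlt hcons
    have hmc : m ≠ c := fun he => by rw [← he] at hcx; linarith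
    have hnc : n ≠ c := fun he => by
      subst he
      have := h.ne n m hn hlt.le hcy.le
      subst this
      exact lt_irrefl _ hlt
    have hp' : Rightward (-x') y' p := hp.of_imp
      (fun u v huv hlt => by simpa [hx v u huv.symm] using hlt) hye
    have hq' : Rightward (-y') x' q := hq.of_imp
      (fun u v huv hlt => by simpa [hy v u huv.symm] using hlt) hxe
    have h1 := hp'.x_lt hmc
    have h2 := hq'.x_lt hnc
    have h3 := hp'.y_eq
    have h4 := hq'.y_eq
    simp only [Pi.neg_apply, neg_lt_neg_iff] at h1 h2
    refine .inr ?_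
    rcases hP with rfl | ⟨hP1, hP2⟩
    · constructor <;> linarith
    · constructor <;> linarith

/-- Corners are the same vertices in both grids. If `w` lies beyond the corner `v`, a corner
dominating `w` also dominates `v`, so the antichain property makes it equal to `v`, and `w` is
squeezed onto `v`. -/
theorem IsTidy.cornersFree_of_lt_iff (h : IsTidy G x y) (h' : IsGrid G x' y')
    (hx : ∀ u v, G.Adj u v → (x u < x v ↔ x' u < x' v))
    (hy : ∀ u v, G.Adj u v → (y u < y v ↔ y' u < y' v)) : CornersFree G x' y' := by
  intro v w hv hvx hvy
  obtain ⟨m, hm, hmx, hmy⟩ := h'.exists_corner_ge w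
  have hv0 : IsNECorner G x y v :=
    hv.of_lt_iff (fun u v huv => (hx u v huv).symm) (fun u v huv => (hy u v huv).symm)
  have hm0 : IsNECorner G x y m :=
    hm.of_lt_iff (fun u v huv => (hx u v huv).symm) (fun u v huv => (hy u v huv).symm)
  have hvm : m = v := by
    rcases lt_trichotomy (x m) (x v) with hlt | heq | hlt
    · linarith [(h.corners_antichain hx hy hv0 hm0 hlt).1]
    · rcases le_total (y m) (y v) with hle | hle
      · exact (h.ne m v hm0 heq.le hle |>.symm)
      · exact h.ne v m hv0 heq.ge hle
    · linarith [(h.corners_antichain hx hy hm0 hv0 hlt).2]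
  subst hvm
  exact h'.injective _ _ (by linarith) (by linarith)

/-- Tidiness depends on the directions of the edges only. -/
theorem IsTidy.of_lt_iff (h : IsTidy G x y) (h' : IsGrid G x' y')
    (hx : ∀ u v, G.Adj u v → (x u < x v ↔ x' u < x' v))
    (hy : ∀ u v, G.Adj u v → (y u < y v ↔ y' u < y' v)) : IsTidy G x' y' := by
  have hx' : ∀ u v, G.Adj u v → ((-x) u < (-x) v ↔ (-x') u < (-x') v) := fun u v huv => by
    simpa using hx v u huv.symm
  have hy' : ∀ u v, G.Adj u v → ((-y) u < (-y) v ↔ (-y') u < (-y') v) := fun u v huv => by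
    simpa using hy v u huv.symm
  exact {
    toIsGrid := h'
    ne := h.cornersFree_of_lt_iff h' hx hy
    nw := h.negX.cornersFree_of_lt_iff h'.negX hx' hy
    se := h.negY.cornersFree_of_lt_iff h'.swap.negX.swap hx hy'
    sw := h.negX.negY.cornersFree_of_lt_iff h'.negX.swap.negX.swap hx' hy' }

end Finite

end

/-! ### The orthogonal hull and its boundary staircases. -/

section

variable {V : Type*} {G : SimpleGraph V} {x y : V → ℝ}

/-- Each of the four closed quadrants at `(a, b)` contains a vertex. -/
structure InHull (x y : V → ℝ) (a b : ℝ) : Prop where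
  ne : ∃ v, a ≤ x v ∧ b ≤ y v
  nw : ∃ v, x v ≤ a ∧ b ≤ y v
  se : ∃ v, a ≤ x v ∧ y v ≤ b
  sw : ∃ v, x v ≤ a ∧ y v ≤ b

namespace InHull

variable {a b : ℝ}

theorem swap (h : InHull x y a b) : InHull y x b a where
  ne := h.ne.imp fun _ => And.symm
  nw := h.se.imp fun _ => And.symm
  se := h.nw.imp fun _ => And.symm
  sw := h.sw.imp fun _ => And.symm

theorem negX (h : InHull x y a b) : InHull (-x) y (-a) b where
  ne := by simpa using h.nw
  nw := by simpa using h.ne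
  se := by simpa using h.sw
  sw := by simpa using h.se

theorem rotate (h : InHull x y a b) : InHull y (-x) b (-a) := h.negX.swap

end InHull

/-- The point `(a, b)` of the hull is on its boundary staircase to the upper right: there are no
vertices in the open quadrant beyond it. -/
def OnStair (x y : V → ℝ) (a b : ℝ) : Prop :=
  InHull x y a b ∧ ∀ v, a < x v → y v ≤ b

theorem OnStair.swap {a b : ℝ} (h : OnStair x y a b) : OnStair y x b a :=
  ⟨h.1.swap, fun v hv => not_lt.1 fun hlt => not_lt.2 (h.2 v hlt) hv⟩

/-- `r` is rightmost, and topmost among the rightmost vertices. -/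
def IsRightmost (x y : V → ℝ) (r : V) : Prop :=
  ∀ w, x w < x r ∨ x w = x r ∧ y w ≤ y r

theorem IsRightmost.x_le {r : V} (h : IsRightmost x y r) (w : V) : x w ≤ x r := by
  rcases h w with h | h
  · exact h.le
  · exact h.1.le

theorem IsRightmost.isNECorner {r : V} (hg : IsGrid G x y) (h : IsRightmost x y r) :
    IsNECorner G x y r := by
  intro u hu
  have := h u
  have := hg.rectilinear r u hu
  grind

theorem exists_isRightmost [Finite V] [Nonempty V] (x y : V → ℝ) : ∃ r, IsRightmost x y r := by
  obtain ⟨m, hm⟩ := Finite.exists_max x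
  obtain ⟨r, hr, hr'⟩ := Set.exists_max_image {r | x r = x m} y (Set.toFinite _) ⟨m, rfl⟩
  refine ⟨r, fun w => ?_⟩
  rw [Set.mem_ofPred_eq] at hr
  rcases (hm w).lt_or_eq with h | h
  · exact .inl (by linarith)
  · exact .inr ⟨by linarith, hr' w h⟩

theorem IsGrid.inHull_of_inBox (h : IsGrid G x y) {u v : V} (huv : G.Adj u v) {a b : ℝ}
    (hab : InBox x y u v a b) : InHull x y a b := by
  have key : ∀ u v, G.Adj u v → x u = x v → y u ≤ y v → InBox x y u v a b → InHull x y a b := by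
    intro u v huv hx hy ⟨h1, h2⟩
    rw [hx, Set.uIcc_self, Set.mem_singleton_iff] at h1
    rw [Set.uIcc_of_le hy] at h2
    exact ⟨⟨v, h1.le, h2.2⟩, ⟨v, h1.ge, h2.2⟩, ⟨u, by linarith, h2.1⟩, ⟨u, by linarith, h2.1⟩⟩
  have key' : ∀ u v, G.Adj u v → y u = y v → x u ≤ x v → InBox x y u v a b → InHull x y a b := by
    intro u v huv hx hy ⟨h2, h1⟩
    rw [hx, Set.uIcc_self, Set.mem_singleton_iff] at h1
    rw [Set.uIcc_of_le hy] at h2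
    exact ⟨⟨v, h2.2, h1.le⟩, ⟨u, h2.1, by linarith⟩, ⟨v, h2.2, h1.ge⟩, ⟨u, h2.1, by linarith⟩⟩
  rcases h.rectilinear u v huv with he | he
  · rcases le_total (y u) (y v) with hle | hle
    · exact key u v huv he hle hab
    · exact key v u huv.symm he.symm hle hab.symm
  · rcases le_total (x u) (x v) with hle | hle
    · exact key' u v huv he hle hab
    · exact key' v u huv.symm he.symm hle hab.symm

/-- Otherwise all neighbours of `v` are straight below it, and of two such neighbours the nearer
would lie on the edge to the farther. -/
theorem IsNECorner.exists_left (h : IsGrid G x y) {v : V} (hv : IsNECorner G x y v) :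
    ∃ u, G.Adj v u ∧ x u < x v ∧ y u = y v := by
  by_contra! hcon
  have hdown : ∀ u, G.Adj v u → x u = x v ∧ y u < y v := by
    intro u hu
    have h1 := hv u hu
    have h2 := hcon u hu
    have h3 := h.rectilinear v u hu
    have h4 : x u = x v := by grind
    refine ⟨h4, lt_of_le_of_ne h1.2 fun he => ?_⟩
    exact hu.ne (h.injective _ _ h4 he).symm
  have key : ∀ u w, u ≠ w → G.Adj v u → G.Adj v w → y u ≤ y w → False := by
    intro u w hne hu hw hle
    have h1 := hdown u hu
    have h2 := hdown w hw
    rcases h.eq_or_eq_of_inBox (w := w) hu ⟨by rw [h1.1, h2.1]; simp,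
      by rw [Set.mem_uIcc]; right; constructor <;> linarith⟩ with he | he
    · exact hw.ne he.symm
    · exact hne he.symm
  obtain ⟨u, w, hne, hu, hw⟩ := h.two_neighbors v
  rcases le_total (y u) (y w) with hle | hle
  · exact key u w hne hu hw hle
  · exact key w u hne.symm hw hu hle

/-- Each staircase is nondegenerate: `r`, being a corner, has a neighbour to its left at the same
height, whereas `t` is leftmost among the topmost vertices. -/
theorem IsRightmost.ne (h : IsGrid G x y) {r t : V} (hr : IsRightmost x y r)
    (ht : IsRightmost y (-x) t) : r ≠ t := by
  rintro rfl
  obtain ⟨u, -, hux, huy⟩ := (hr.isNECorner h).exists_left h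
  rcases ht u with h1 | h1
  · linarith
  · have := h1.2
    simp only [Pi.neg_apply] at this
    linarith

/-- A walk leading up and to the left along the upper right staircase. -/
structure IsStaircase (x y : V → ℝ) {u v : V} (p : G.Walk u v) : Prop where
  mono : ∀ d ∈ p.darts, x d.snd ≤ x d.fst ∧ y d.fst ≤ y d.snd
  onStair : ∀ d ∈ p.darts, ∀ a b, InBox x y d.fst d.snd a b → OnStair x y a b

namespace IsStaircase

theorem nil {u : V} : IsStaircase x y (.nil : G.Walk u u) := ⟨by simp, by simp⟩

theorem append {u v w : V} {p : G.Walk u v} {q : G.Walk v w} (hp : IsStaircase x y p)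
    (hq : IsStaircase x y q) : IsStaircase x y (p.append q) := by
  constructor <;> intro d hd <;>
    rw [SimpleGraph.Walk.darts_append, List.mem_append] at hd <;> rcases hd with hd | hd
  · exact hp.mono d hd
  · exact hq.mono d hd
  · exact hp.onStair d hd
  · exact hq.onStair d hd

theorem reverse_swap {u v : V} {p : G.Walk u v} (hp : IsStaircase y x p) :
    IsStaircase x y p.reverse := by
  constructor <;> intro d hd <;>
    rw [SimpleGraph.Walk.darts_reverse, List.mem_reverse, List.mem_map] at hd <;>
    obtain ⟨d, hd, rfl⟩ := hd
  · exact (hp.mono d hd).symm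
  · exact fun a b hab => (hp.onStair d hd b a hab.symm.swap).swap

theorem mono_support {u v : V} {p : G.Walk u v} (hp : IsStaircase x y p) :
    ∀ w ∈ p.support, x v ≤ x w ∧ y u ≤ y w ∧ x w ≤ x u := by
  induction p with
  | nil => simp
  | @cons u m v hadj p ih =>
    have h1 := hp.mono ⟨(u, m), hadj⟩ (by simp)
    have ih := ih ⟨fun d hd => hp.mono d (by simp [hd]), fun d hd => hp.onStair d (by simp [hd])⟩
    have h2 := ih m (by simp)
    intro w hw
    rw [SimpleGraph.Walk.support_cons, List.mem_cons] at hw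
    rcases hw with rfl | hw
    · exact ⟨h2.1.trans h1.1, le_rfl, le_rfl⟩
    · exact ⟨(ih w hw).1, h1.2.trans (ih w hw).2.1, (ih w hw).2.2.trans h1.1⟩

theorem isPath (h : IsGrid G x y) {u v : V} {p : G.Walk u v} (hp : IsStaircase x y p) :
    p.IsPath := by
  induction p with
  | nil => simp
  | @cons u m v hadj p ih =>
    have h1 := hp.mono ⟨(u, m), hadj⟩ (by simp)
    have h2 : IsStaircase x y p :=
      ⟨fun d hd => hp.mono d (by simp [hd]), fun d hd => hp.onStair d (by simp [hd])⟩
    rw [SimpleGraph.Walk.cons_isPath_iff]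
    refine ⟨ih h2, fun hu => ?_⟩
    obtain ⟨-, hy, hx⟩ := h2.mono_support u hu
    exact hadj.ne (h.injective _ _ (le_antisymm hx h1.1) (le_antisymm h1.2 hy))

theorem onStair_support {u v : V} {p : G.Walk u v} (hp : IsStaircase x y p) (hne : u ≠ v)
    {w : V} (hw : w ∈ p.support) : OnStair x y (x w) (y w) := by
  obtain ⟨e, he, hwe⟩ := (SimpleGraph.Walk.mem_support_iff_exists_mem_edges_of_not_nil
    (SimpleGraph.Walk.not_nil_of_ne hne)).1 hw
  obtain ⟨d, hd, rfl⟩ := List.mem_map.1 he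
  refine hp.onStair d hd _ _ ?_
  change w ∈ s(d.fst, d.snd) at hwe
  rcases Sym2.mem_iff.1 hwe with rfl | rfl
  · exact ⟨Set.left_mem_uIcc, Set.left_mem_uIcc⟩
  · exact ⟨Set.right_mem_uIcc, Set.right_mem_uIcc⟩

end IsStaircase

theorem Rightward.dart_le {u v : V} {p : G.Walk u v} (hp : Rightward x y p) :
    ∀ d ∈ p.darts, x d.snd ≤ x v ∧ y d.snd = y v := by
  induction p with
  | nil => simp
  | cons hadj p ih =>
    simp only [Rightward, SimpleGraph.Walk.darts_cons, List.mem_cons, forall_eq_or_imp] at hp ⊢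
    exact ⟨⟨Rightward.x_le (y := y) hp.2, Rightward.y_eq (x := x) hp.2⟩, ih hp.2⟩

theorem Rightward.isStaircase (h : IsGrid G x y) {u v : V} {p : G.Walk u v}
    (hp : Rightward (-x) y p) (hfree : ∀ w, x v < x w → y w ≤ y u) : IsStaircase x y p := by
  constructor
  · intro d hd
    have := hp d hd
    simp only [Pi.neg_apply, neg_lt_neg_iff] at this
    exact ⟨this.1.le, this.2.le⟩
  · intro d hd a b hab
    refine ⟨h.inHull_of_inBox d.adj hab, fun w hw => ?_⟩
    have h1 := hp d hd
    have h2 := hp.dart_le d hd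
    have h3 := hp.y_eq
    simp only [Pi.neg_apply, neg_lt_neg_iff, neg_le_neg_iff] at h1 h2
    obtain ⟨hax, hby⟩ := hab
    rw [h1.2, Set.uIcc_self, Set.mem_singleton_iff] at hby
    rw [Set.uIcc_of_ge h1.1.le, Set.mem_Icc] at hax
    rw [hby, h2.2, ← h3]
    exact hfree w (by linarith)

section Finite

variable [Finite V]

/-- The last piece of the staircase, along the top side. A leftward walk that stalls on the top line
does so at an upper left corner, and `t` lies in the quadrant beyond it. -/
theorem IsTidy.exists_top_walk (h : IsTidy G x y) {s t : V} (hs : IsRightmost y x s)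
    (ht : IsRightmost y (-x) t) : ∃ p : G.Walk s t, Rightward (-x) y p := by
  have hst : y s = y t := le_antisymm (ht.x_le s) (hs.x_le t)
  have hle : x t ≤ x s := by
    have := ht s
    simp only [Pi.neg_apply] at this
    grind
  obtain ⟨p, w, hw, hap, hpm, hpy, hp⟩ := exists_leftward_walk G x y hle
  have hcor : IsNECorner G (-x) y p := by
    intro u hu
    simp only [Pi.neg_apply, neg_le_neg_iff]
    refine ⟨?_, by rw [hpy]; exact hs.x_le u⟩
    by_contra! hlt
    have h1 := hp u hu (by grind [h.rectilinear p u hu]) hlt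
    have h2 := ht u
    simp only [Pi.neg_apply] at h2
    grind [h.rectilinear p u hu]
  have := h.nw p t hcor (by simpa using hap) (by linarith)
  subst this
  exact ⟨w, hw⟩

/-- The upper right boundary is traced by a walk. -/
theorem IsTidy.exists_isStaircase (h : IsTidy G x y) {r t : V} (hr : IsRightmost x y r)
    (ht : IsRightmost y (-x) t) : ∃ p : G.Walk r t, IsStaircase x y p := by
  have : Nonempty V := ⟨r⟩
  obtain ⟨s, hs⟩ := exists_isRightmost y x
  have hrc := hr.isNECorner h.toIsGrid
  have hsc : IsNECorner G x y s := (hs.isNECorner h.toIsGrid.swap).swap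
  obtain ⟨q, hq⟩ := h.exists_top_walk hs ht
  have hq' : IsStaircase x y q := hq.isStaircase h.toIsGrid fun w _ => hs.x_le w
  suffices hrs : ∃ p : G.Walk r s, IsStaircase x y p by
    obtain ⟨p, hp⟩ := hrs
    exact ⟨p.append q, hp.append hq'⟩
  rcases (hr.x_le s).lt_or_eq with hlt | heq
  -- The two chains between successive corners are appended one corner at a time. The second chain
  -- is listed downwards, so it is a staircase for the swapped coordinates and has to be reversed.
  · refine h.corner_induction (P := fun n => ∃ p : G.Walk r n, IsStaircase x y p) hrc
      ⟨.nil, .nil⟩ (fun m n hm hn hlt hcons hP => ?_) s hsc hlt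
    obtain ⟨p, hp⟩ := hP
    obtain ⟨c, p1, p2, hp1, hp2, hcx, hcy⟩ := h.exists_step hm hn hlt hcons
    have free := h.le_of_successive hm hcons
    have hs1 : IsStaircase x y p1 := hp1.isStaircase h.toIsGrid fun w hw => free w (by linarith)
    have hs2 : IsStaircase y x p2 := hp2.isStaircase h.toIsGrid.swap fun w hw => by
      by_contra! hlt
      linarith [free w hlt]
    exact ⟨p.append (p1.append p2.reverse), hp.append (hs1.append hs2.reverse_swap)⟩
  · have : s = r := h.ne r s hrc heq.ge (hs.x_le r)
    subst this
    exact ⟨.nil, .nil⟩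

end Finite

theorem SimpleGraph.Walk.exists_dart_le_le (g : V → ℝ) {u v : V} (p : G.Walk u v) (hne : u ≠ v)
    {s : ℝ} (hu : g u ≤ s) (hv : s ≤ g v) : ∃ d ∈ p.darts, g d.fst ≤ s ∧ s ≤ g d.snd := by
  induction p with
  | nil => exact absurd rfl hne
  | @cons u m v hadj p ih =>
    rcases le_or_gt s (g m) with hs | hs
    · exact ⟨⟨(u, m), hadj⟩, by simp, hu, hs⟩
    · obtain ⟨d, hd, h⟩ := ih (fun he => by subst he; linarith) hs.le hv
      exact ⟨d, by simp [hd], h⟩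

/-- The function `y - x` does not decrease along the walk, so some edge contains a point with the
same difference as `(a, b)`. Two distinct staircase points cannot have equal differences: one would
lie in the open quadrant beyond the other, and the hull would put a vertex there. -/
theorem IsStaircase.exists_inBox (h : IsGrid G x y) {r t : V} {p : G.Walk r t}
    (hp : IsStaircase x y p) (hr : IsRightmost x y r) (ht : IsRightmost y (-x) t) {a b : ℝ}
    (hab : OnStair x y a b) (hb : y r ≤ b) : ∃ d ∈ p.darts, InBox x y d.fst d.snd a b := by
  obtain ⟨v, hva, hvb⟩ := hab.1.ne
  obtain ⟨v', hva', hvb'⟩ := hab.1.nw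
  have ha : a ≤ x r := hva.trans (hr.x_le v)
  have hbt : b ≤ y t := hvb.trans (ht.x_le v)
  have hat : x t ≤ a := by
    by_contra! hlt
    have h1 := hab.2 t hlt
    have h2 := ht v'
    simp only [Pi.neg_apply] at h2
    rcases h2 with h2 | h2 <;> linarith
  obtain ⟨d, hd, h1, h2⟩ := p.exists_dart_le_le (fun v => y v - x v) (hr.ne h ht)
    (s := b - a) (by linarith) (by linarith)
  obtain ⟨hdx, hdy⟩ := hp.mono d hd
  obtain ⟨a', b', hbox, hdiff⟩ : ∃ a' b', InBox x y d.fst d.snd a' b' ∧ b' - a' = b - a := by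
    rcases h.rectilinear _ _ d.adj with he | he
    · refine ⟨x d.fst, x d.fst + (b - a), ⟨by simp, ?_⟩, by ring⟩
      rw [Set.uIcc_of_le hdy]
      constructor <;> linarith
    · refine ⟨y d.fst - (b - a), y d.fst, ⟨?_, by simp⟩, by ring⟩
      rw [Set.uIcc_of_ge hdx]
      constructor <;> linarith
  have hst := hp.onStair d hd a' b' hbox
  have haa : a = a' := by
    obtain ⟨w, hwa, hwb⟩ := hst.1.ne
    rcases lt_trichotomy a a' with hlt | heq | hlt
    · linarith [hab.2 w (by linarith)]
    · exact heq
    · linarith [hst.2 v (by linarith)]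
  have hbb : b = b' := by linarith
  subst haa hbb
  exact ⟨d, hd, hbox⟩

/-- The point `(a, b)` is on one of the four staircases that bound the hull. -/
def OnFrontier (x y : V → ℝ) (a b : ℝ) : Prop :=
  OnStair x y a b ∨ OnStair y (-x) b (-a) ∨ OnStair (-x) (-y) (-a) (-b) ∨ OnStair (-y) x (-b) a

/-- A vertex on two opposite staircases separates the vertices above it to the left from those
below it to the right. -/
theorem IsGrid.opposite_stairs_disjoint (h : IsGrid G x y)
    (hcut : ∀ v a b, a ≠ v → b ≠ v → ∃ p : G.Walk a b, v ∉ p.support) {v a b : V}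
    (h1 : OnStair x y (x v) (y v)) (h2 : OnStair (-x) (-y) (-x v) (-y v)) (ha : a ≠ v)
    (hb : b ≠ v) (hax : x a ≤ x v) (hay : y v ≤ y a) (hbx : x v ≤ x b) (hby : y b ≤ y v) :
    False := by
  -- A walk from `a` to `b` avoiding `v` has to leave the closed upper left quadrant at `v`. The two
  -- open quadrants beyond the staircases are empty, so the leaving edge ends in the lower right
  -- quadrant and passes through `v`.
  obtain ⟨p, hp⟩ := hcut v a b ha hb
  obtain ⟨d, hd, ⟨hd1, hd2⟩, hd3⟩ := p.exists_boundary_dart {w | x w ≤ x v ∧ y v ≤ y w} ⟨hax, hay⟩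
    fun ⟨h1, h2⟩ => hb (h.injective _ _ (le_antisymm h1 hbx) (le_antisymm hby h2))
  have h3 := h1.2 d.snd
  have h4 := h2.2 d.snd
  simp only [Pi.neg_apply, neg_lt_neg_iff, neg_le_neg_iff] at h4
  have h5 : x v ≤ x d.snd ∧ y d.snd ≤ y v := by
    by_contra hcon
    apply hd3
    rw [Set.mem_ofPred_eq]
    grind
  rcases h.eq_or_eq_of_inBox (w := v) d.adj
    ⟨by rw [Set.mem_uIcc]; exact .inl ⟨hd1, h5.1⟩, by rw [Set.mem_uIcc]; exact .inr ⟨h5.2, hd2⟩⟩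
    with he | he
  · exact hp (he ▸ p.dart_fst_mem_support_of_mem_darts hd)
  · exact hp (he ▸ p.dart_snd_mem_support_of_mem_darts hd)

end

/-! ### The boundary cycle of the hull. -/

section

variable {V : Type*} {G : SimpleGraph V} {x y : V → ℝ}

theorem inBox_rotate_iff {u v : V} {a b : ℝ} :
    InBox y (-x) u v b (-a) ↔ InBox x y u v a b := by
  refine ⟨fun h => ?_, fun h => h.negX.swap⟩
  simpa using h.swap.negX

theorem SimpleGraph.Walk.IsPath.append {u v w : V} {p : G.Walk u v} {q : G.Walk v w}
    (hp : p.IsPath) (hq : q.IsPath) (h : ∀ z ∈ p.support, z ∈ q.support → z = v) :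
    (p.append q).IsPath := by
  rw [SimpleGraph.Walk.isPath_def] at *
  rw [SimpleGraph.Walk.support_append, List.nodup_append']
  refine ⟨hp, hq.tail, fun z hz hz' => ?_⟩
  have := h z hz (List.mem_of_mem_tail hz')
  subst this
  rw [← SimpleGraph.Walk.cons_tail_support, List.nodup_cons] at hq
  exact hq.1 hz'

theorem SimpleGraph.Walk.IsPath.start_notMem_tail {u v : V} {p : G.Walk u v} (hp : p.IsPath) :
    u ∉ p.support.tail := by
  rw [SimpleGraph.Walk.isPath_def, ← SimpleGraph.Walk.cons_tail_support, List.nodup_cons] at hp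
  exact hp.1

/-- A common vertex would separate the ends `r₁` and `r₃` of the two staircases, so it would be a
cut vertex. -/
theorem IsStaircase.disjoint_opposite (h : IsGrid G x y)
    (hcut : ∀ v a b, a ≠ v → b ≠ v → ∃ p : G.Walk a b, v ∉ p.support)
    {r₀ r₁ r₂ r₃ v : V} {p : G.Walk r₀ r₁} {q : G.Walk r₂ r₃} (h₀ : IsRightmost x y r₀)
    (h₁ : IsRightmost y (-x) r₁) (h₂ : IsRightmost (-x) (-y) r₂) (h₃ : IsRightmost (-y) x r₃)
    (hp : IsStaircase x y p) (hq : IsStaircase (-x) (-y) q)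
    (hvp : v ∈ p.support) (hvq : v ∈ q.support) : False := by
  have n₀ : r₀ ≠ r₁ := h₀.ne h h₁
  have n₁ : r₁ ≠ r₂ := h₁.ne h.negX.swap h₂
  have n₂ : r₂ ≠ r₃ := h₂.ne h.negX.swap.negX.swap (by simpa using h₃)
  have n₃ : r₃ ≠ r₀ := h₃.ne h.swap.negX (by simpa using h₀)
  have b1 := hp.mono_support v hvp
  have b2 := hq.mono_support v hvq
  have s1 := hp.onStair_support n₀ hvp
  have s2 := hq.onStair_support n₂ hvq
  have m1 := h₁ r₂
  have m2 := h₂ r₁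
  have m3 := h₃ r₀
  have m0 := h₀ r₃
  have m4 := h₁.x_le v
  have m5 := h₃.x_le v
  simp only [Pi.neg_apply, neg_le_neg_iff, neg_lt_neg_iff, neg_inj] at *
  refine h.opposite_stairs_disjoint hcut s1 s2 (a := r₁) (b := r₃) ?_ ?_ b1.1 m4 b2.1 m5
  · rintro rfl
    exact n₁ (h.injective _ _ (by grind) (by grind))
  · rintro rfl
    exact n₃ (h.injective _ _ (by grind) (by grind))

/-- The walk `p` starts at the topmost of the rightmost vertices. Points of the staircase set below
that vertex lie on the right side of the hull, which is traced by the preceding walk `q`. -/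
theorem OnStair.exists_inBox (h : IsGrid G x y) {r t s : V} {p : G.Walk r t} {q : G.Walk s r}
    (hr : IsRightmost x y r) (ht : IsRightmost y (-x) t) (hs : IsRightmost (-y) x s)
    (hp : IsStaircase x y p) (hq : IsStaircase (-y) x q) {a b : ℝ} (hab : OnStair x y a b) :
    ∃ d, (d ∈ p.darts ∨ d ∈ q.darts) ∧ InBox x y d.fst d.snd a b := by
  rcases le_or_gt (y r) b with hb | hb
  · obtain ⟨d, hd, hbox⟩ := hp.exists_inBox h hr ht hab hb
    exact ⟨d, .inl hd, hbox⟩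
  · have ha : x r ≤ a := not_lt.1 fun hlt => not_lt.2 (hab.2 r hlt) hb
    have hst : OnStair (-y) x (-b) a :=
      ⟨hab.1.swap.negX, fun v _ => (hr.x_le v).trans ha⟩
    obtain ⟨d, hd, hbox⟩ := hq.exists_inBox h.swap.negX hs (by simpa using hr) hst
      ((hr.x_le s).trans ha)
    exact ⟨d, .inr hd, by simpa using hbox.negX.swap⟩

section Finite

variable [Finite V]

/-- Monotonicity of both walks puts `v` on the vertical line of `t`. The top side has positive
length, so its right end `c` is strictly to the right of `v`; being on the staircase, `v` must then
be as high as `c`. -/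
theorem IsStaircase.eq_of_mem_of_mem (h : IsGrid G x y) {r t s v : V} {p : G.Walk r t}
    {q : G.Walk t s} (hr : IsRightmost x y r) (ht : IsRightmost y (-x) t)
    (hp : IsStaircase x y p) (hq : IsStaircase y (-x) q)
    (hvp : v ∈ p.support) (hvq : v ∈ q.support) : v = t := by
  have : Nonempty V := ⟨r⟩
  have h1 := hp.mono_support v hvp
  have h2 := hq.mono_support v hvq
  have h3 := hp.onStair_support (hr.ne h ht) hvp
  obtain ⟨c, hc⟩ := exists_isRightmost y x
  obtain ⟨u, -, hux, huy⟩ :=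
    IsNECorner.exists_left h (v := c) (hc.isNECorner h.swap).swap
  have h4 := ht u
  simp only [Pi.neg_apply, neg_le_neg_iff] at h2 h4
  have h5 := hc.x_le t
  have h6 := h3.2 c (by grind)
  exact h.injective _ _ (by linarith) (by linarith)

/-- The boundary of the hull is traced by a cycle. -/
theorem IsTidy.exists_isCycle [Nonempty V] (h : IsTidy G x y)
    (hcut : ∀ v a b, a ≠ v → b ≠ v → ∃ p : G.Walk a b, v ∉ p.support) :
    ∃ (v : V) (c : G.Walk v v), c.IsCycle ∧
      ∀ a b, (∃ d ∈ c.darts, InBox x y d.fst d.snd a b) ↔ OnFrontier x y a b := by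
  have t₁ : IsTidy G y (-x) := h.rotate
  have t₂ : IsTidy G (-x) (-y) := t₁.rotate
  have t₃ : IsTidy G (-y) x := by simpa using t₂.rotate
  obtain ⟨r₀, h₀⟩ := exists_isRightmost x y
  obtain ⟨r₁, h₁⟩ := exists_isRightmost y (-x)
  obtain ⟨r₂, h₂⟩ := exists_isRightmost (-x) (-y)
  obtain ⟨r₃, h₃⟩ := exists_isRightmost (-y) x
  have h₃' : IsRightmost (-y) (- -x) r₃ := by simpa using h₃
  have h₀' : IsRightmost x (- -y) r₀ := by simpa using h₀
  have h₀'' : IsRightmost (- -x) y r₀ := by simpa using h₀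
  have h₁' : IsRightmost (- -y) (-x) r₁ := by simpa using h₁
  obtain ⟨p₀, s₀⟩ := h.exists_isStaircase h₀ h₁
  obtain ⟨p₁, s₁⟩ := t₁.exists_isStaircase h₁ h₂
  obtain ⟨p₂, s₂⟩ := t₂.exists_isStaircase h₂ h₃'
  obtain ⟨p₃, s₃⟩ := t₃.exists_isStaircase h₃ h₀'
  have s₃' : IsStaircase (-y) (- -x) p₃ := by simpa using s₃
  have s₀' : IsStaircase x (- -y) p₀ := by simpa using s₀
  have d₀₁ := fun v => IsStaircase.eq_of_mem_of_mem h.toIsGrid h₀ h₁ s₀ s₁ (v := v)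
  have d₂₃ := fun v => IsStaircase.eq_of_mem_of_mem t₂.toIsGrid h₂ h₃' s₂ s₃' (v := v)
  have d₁₂ := fun v => IsStaircase.eq_of_mem_of_mem t₁.toIsGrid h₁ h₂ s₁ s₂ (v := v)
  have d₃₀ := fun v => IsStaircase.eq_of_mem_of_mem t₃.toIsGrid h₃ h₀' s₃ s₀' (v := v)
  have d₀₂ := fun v => IsStaircase.disjoint_opposite h.toIsGrid hcut h₀ h₁ h₂ h₃ s₀ s₂ (v := v)
  have d₁₃ := fun v => IsStaircase.disjoint_opposite t₁.toIsGrid hcut h₁ h₂ h₃' h₀'' s₁ s₃' (v := v)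
  have n₀ : r₀ ≠ r₁ := h₀.ne h.toIsGrid h₁
  have n₁ : r₁ ≠ r₂ := h₁.ne t₁.toIsGrid h₂
  have hP := (s₀.isPath h.toIsGrid).append (s₁.isPath t₁.toIsGrid) d₀₁
  have hQ := (s₂.isPath t₂.toIsGrid).append (s₃.isPath t₃.toIsGrid) d₂₃
  refine ⟨r₀, (p₀.append p₁).append (p₂.append p₃), hP.isCycle_append hQ ?_ (.inl ?_), ?_⟩
  · intro v hv hv'
    have m := List.mem_of_mem_tail hv
    have m' := List.mem_of_mem_tail hv'
    rw [SimpleGraph.Walk.mem_support_append_iff] at m m'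
    rcases m with m | m <;> rcases m' with m' | m'
    · exact d₀₂ v m m'
    · rw [d₃₀ v m' m] at hv
      exact hP.start_notMem_tail hv
    · rw [d₁₂ v m m'] at hv'
      exact hQ.start_notMem_tail hv'
    · exact d₁₃ v m m'
  · rw [SimpleGraph.Walk.length_append]
    have l₀ : p₀.length ≠ 0 := fun he => n₀ (SimpleGraph.Walk.eq_of_length_eq_zero he)
    have l₁ : p₁.length ≠ 0 := fun he => n₁ (SimpleGraph.Walk.eq_of_length_eq_zero he)
    omega
  · intro a b
    simp only [SimpleGraph.Walk.darts_append, List.mem_append]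
    constructor
    · rintro ⟨d, (hd | hd) | hd | hd, hab⟩
      · exact .inl (s₀.onStair d hd _ _ hab)
      · exact .inr (.inl (s₁.onStair d hd _ _ (inBox_rotate_iff.2 hab)))
      · exact .inr (.inr (.inl (s₂.onStair d hd _ _
          (inBox_rotate_iff.2 (inBox_rotate_iff.2 hab)))))
      · exact .inr (.inr (.inr (s₃.onStair d hd _ _ hab.swap.negX)))
    · rintro (hab | hab | hab | hab)
      · obtain ⟨d, hd, hbox⟩ := hab.exists_inBox h.toIsGrid h₀ h₁ h₃ s₀ s₃
        exact ⟨d, by tauto, hbox⟩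
      · obtain ⟨d, hd, hbox⟩ := hab.exists_inBox t₁.toIsGrid h₁ h₂ h₀'' (s := r₀) (q := p₀)
          s₁ (by simpa using s₀)
        exact ⟨d, by tauto, inBox_rotate_iff.1 hbox⟩
      · obtain ⟨d, hd, hbox⟩ := hab.exists_inBox t₂.toIsGrid h₂ h₃' (s := r₁) (q := p₁) h₁'
          s₂ (by simpa using s₁)
        exact ⟨d, by tauto, inBox_rotate_iff.1 (inBox_rotate_iff.1 hbox)⟩
      · obtain ⟨d, hd, hbox⟩ := hab.exists_inBox t₃.toIsGrid h₃ h₀' (s := r₂) (q := p₂) h₂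
          s₃ s₂
        exact ⟨d, by tauto, by simpa using hbox.negX.swap⟩

end Finite

end

/-! ### Maximal empty boxes and their sides. -/

section

variable {V : Type*} {G : SimpleGraph V} {x y : V → ℝ}

/-- The point `(a, b)` lies on an edge. -/
def Drawn (G : SimpleGraph V) (x y : V → ℝ) (a b : ℝ) : Prop :=
  ∃ u v, G.Adj u v ∧ InBox x y u v a b

theorem Drawn.swap {a b : ℝ} (h : Drawn G x y a b) : Drawn G y x b a := by
  obtain ⟨u, v, huv, hab⟩ := h
  exact ⟨u, v, huv, hab.swap⟩

theorem Drawn.negX {a b : ℝ} (h : Drawn G x y a b) : Drawn G (-x) y (-a) b := by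
  obtain ⟨u, v, huv, hab⟩ := h
  exact ⟨u, v, huv, hab.negX⟩

theorem drawn_negX_iff {a b : ℝ} : Drawn G (-x) y a b ↔ Drawn G x y (-a) b :=
  ⟨fun h => by simpa using h.negX, fun h => by simpa using h.negX⟩

theorem drawn_negY_iff {a b : ℝ} : Drawn G x (-y) a b ↔ Drawn G x y a (-b) :=
  ⟨fun h => (drawn_negX_iff.1 h.swap).swap, fun h => (drawn_negX_iff.2 h.swap).swap⟩

/-- No edge meets the open box. -/
def Undrawn (G : SimpleGraph V) (x y : V → ℝ) (a b c d : ℝ) : Prop :=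
  ∀ s t, a < s → s < b → c < t → t < d → ¬ Drawn G x y s t

theorem Undrawn.swap {a b c d : ℝ} (h : Undrawn G x y a b c d) : Undrawn G y x c d a b :=
  fun s t h1 h2 h3 h4 hd => h t s h3 h4 h1 h2 hd.swap

theorem Undrawn.negX {a b c d : ℝ} (h : Undrawn G x y a b c d) :
    Undrawn G (-x) y (-b) (-a) c d :=
  fun s t h1 h2 h3 h4 hd => h (-s) t (by linarith) (by linarith) h3 h4 (drawn_negX_iff.1 hd)

theorem IsGrid.drawn_vertex (h : IsGrid G x y) (v : V) : Drawn G x y (x v) (y v) := by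
  obtain ⟨u, -, -, hu, -⟩ := h.two_neighbors v
  exact ⟨v, u, hu, Set.left_mem_uIcc, Set.left_mem_uIcc⟩

/-- A vertical edge ending at height at least `d` that starts below `d` meets the box below. -/
theorem Undrawn.not_below {a b c d : ℝ} (h : Undrawn G x y a b c d) (hcd : c < d) {u v : V}
    (huv : G.Adj u v) (ha : a < x u) (hb : x u < b) (hu : y u < d)
    (hv : d ≤ y v) : False := by
  have hmax : max (y u) c < d := max_lt hu hcd
  obtain ⟨e, he, he'⟩ := exists_between hmax
  refine h (x u) e ha hb ((le_max_right _ _).trans_lt he) he' ⟨u, v, huv, by simp, ?_⟩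
  rw [Set.mem_uIcc]
  exact .inl ⟨(le_max_left _ _).trans he.le, he'.le.trans hv⟩

section Finite

variable [Finite V]

/-- A drawn stretch of the upper side can end towards the left only at a vertex `w`. No edge goes
down from `w` into the empty box, so `w` would be a lower left corner; but points of the box belong
to the hull, which yields a vertex in the quadrant beyond `w`. -/
theorem IsTidy.drawn_left (h : IsTidy G x y) {a b c d s t : ℝ} (hcd : c < d)
    (hfree : Undrawn G x y a b c d)
    (hhull : ∀ s t, a < s → s < b → c < t → t < d → InHull x y s t)
    (has : a < s) (hsb : s < b) (hs : Drawn G x y s d) (hat : a ≤ t) (hts : t < s) :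
    Drawn G x y t d := by
  by_cases hex : ∃ w, y w = d ∧ t < x w ∧ x w ≤ s
  · obtain ⟨w, ⟨hwd, htw, hws⟩, hmin⟩ := Set.exists_min_image {w | y w = d ∧ t < x w ∧ x w ≤ s} x
      (Set.toFinite _) hex
    obtain ⟨u, hu, huy, hux⟩ : ∃ u, G.Adj w u ∧ y u = y w ∧ x u < x w := by
      by_contra! hcon
      have hcor : IsNECorner G (-x) (-y) w := by
        intro u hu
        simp only [Pi.neg_apply, neg_le_neg_iff]
        rcases h.rectilinear w u hu with he | he
        · refine ⟨he.le, ?_⟩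
          by_contra! hlt
          exact hfree.not_below hcd hu.symm (by linarith) (by linarith) (by linarith)
            hwd.ge
        · exact ⟨hcon u hu he.symm, he.le⟩
      obtain ⟨v, hvx, hvy⟩ := (hhull ((a + x w) / 2) ((c + d) / 2) (by linarith) (by linarith)
        (by linarith) (by linarith)).sw
      have := h.sw w v hcor (by simp only [Pi.neg_apply]; linarith)
        (by simp only [Pi.neg_apply]; linarith)
      subst this
      linarith
    have hut : x u ≤ t := by
      by_contra! hlt
      linarith [hmin u ⟨by linarith, hlt, by linarith⟩]
    exact ⟨w, u, hu, by rw [Set.mem_uIcc]; exact .inr ⟨hut, htw.le⟩, by rw [huy, hwd]; simp⟩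
  · push Not at hex
    have key : ∀ u v, G.Adj u v → y u = y v → x u ≤ x v → InBox x y u v s d →
        Drawn G x y t d := by
      intro u v huv hy hx ⟨h1, h2⟩
      rw [Set.uIcc_of_le hx, Set.mem_Icc] at h1
      rw [hy, Set.uIcc_self, Set.mem_singleton_iff] at h2
      refine ⟨u, v, huv, ?_, by rw [hy, ← h2]; simp⟩
      rw [Set.uIcc_of_le hx]
      refine ⟨?_, by linarith⟩
      by_contra! hlt
      linarith [hex u (by linarith) hlt]
    have key' : ∀ u v, G.Adj u v → x u = x v → y u ≤ y v → InBox x y u v s d → False := by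
      intro u v huv hx hy ⟨h1, h2⟩
      rw [Set.uIcc_of_le hy, Set.mem_Icc] at h2
      rw [hx, Set.uIcc_self, Set.mem_singleton_iff] at h1
      rcases h2.1.lt_or_eq with hlt | heq
      · exact hfree.not_below hcd huv (by linarith) (by linarith) hlt h2.2
      · linarith [hex u heq (by linarith)]
    obtain ⟨u, v, huv, hbox⟩ := hs
    rcases h.rectilinear u v huv with he | he
    · rcases le_total (y u) (y v) with hle | hle
      · exact (key' u v huv he hle hbox).elim
      · exact (key' v u huv.symm he.symm hle hbox.symm).elim
    · rcases le_total (x u) (x v) with hle | hle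
      · exact key u v huv he hle hbox
      · exact key v u huv.symm he.symm hle hbox.symm

/-- If an empty box inside the hull cannot be extended upwards, its upper side is drawn. -/
theorem IsTidy.top_drawn (h : IsTidy G x y) {a b c a₀ b₀ : ℝ} {u : V}
    (hstair : ∀ a b, OnStair x y a b → Drawn G x y a b)
    (ha : a < a₀) (hb : a₀ < b) (hc : c < b₀) (hu : b₀ < y u)
    (hhull : ∀ s t, (∀ s' ∈ Set.uIcc a₀ s, ∀ t' ∈ Set.uIcc b₀ t, ¬ Drawn G x y s' t') →
      InHull x y s t)
    (hfree : Undrawn G x y a b c (y u))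
    (hmax : ∀ v, Undrawn G x y a b c (y v) → y v ≤ y u) :
    ∀ t, a ≤ t → t ≤ b → Drawn G x y t (y u) := by
  have hboxhull : ∀ s t, a < s → s < b → c < t → t < y u → InHull x y s t := by
    intro s t h1 h2 h3 h4
    refine hhull s t fun s' hs' t' ht' => ?_
    rw [Set.mem_uIcc] at hs' ht'
    exact hfree s' t' (by grind) (by grind) (by grind) (by grind)
  -- If nothing on the open upper side were drawn, the box could be raised to the next vertex level,
  -- against `hmax`. If there is no higher level, `(a₀, y u)` is on the staircase and hence drawn.
  obtain ⟨s, has, hsb, hs⟩ : ∃ s, a < s ∧ s < b ∧ Drawn G x y s (y u) := by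
    by_contra! hcon
    have hex : ∃ v, y u < y v := by
      by_contra! htop
      refine hcon a₀ ha hb (hstair _ _ ⟨hhull _ _ fun s' hs' t' ht' => ?_, fun v _ => htop v⟩)
      rw [Set.uIcc_self, Set.mem_singleton_iff] at hs'
      rw [Set.uIcc_of_le hu.le, Set.mem_Icc] at ht'
      subst hs'
      rcases ht'.2.lt_or_eq with hlt | rfl
      · exact hfree _ _ ha hb (by linarith) hlt
      · exact hcon _ ha hb
    obtain ⟨v, hv, hmin⟩ := Set.exists_min_image {v | y u < y v} y (Set.toFinite _) hex
    refine not_le.2 hv (hmax v fun s t h1 h2 h3 h4 hd => ?_)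
    have hut : y u < t := by
      by_contra! hle
      rcases hle.lt_or_eq with hlt | rfl
      · exact hfree s t h1 h2 h3 hlt hd
      · exact hcon s h1 h2 hd
    -- No vertex level lies strictly between `y u` and `y v`. An edge meeting the added strip is
    -- therefore vertical and crosses the old upper side.
    have key : ∀ p q, G.Adj p q → y p ≤ y q → InBox x y p q s t → False := by
      intro p q hpq hle ⟨hx, hy⟩
      rw [Set.uIcc_of_le hle, Set.mem_Icc] at hy
      have hp : y p ≤ y u := by
        by_contra! hlt
        linarith [hmin p hlt]
      rcases h.rectilinear p q hpq with he | he
      · exact hcon s h1 h2 ⟨p, q, hpq, hx, by rw [Set.uIcc_of_le hle]; exact ⟨hp, by linarith⟩⟩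
      · linarith
    obtain ⟨p, q, hpq, hbox⟩ := hd
    rcases le_total (y p) (y q) with hle | hle
    · exact key p q hpq hle hbox
    · exact key q p hpq.symm hle hbox.symm
  have hcu : c < y u := hc.trans hu
  intro t hat htb
  rcases lt_trichotomy t s with hlt | rfl | hlt
  · exact h.drawn_left hcu hfree hboxhull has hsb hs hat hlt
  · exact hs
  · have := h.negX.drawn_left (s := -s) (t := -t) hcu hfree.negX
      (fun s' t' h1 h2 h3 h4 => by
        simpa using (hboxhull (-s') t' (by linarith) (by linarith) h3 h4).negX)
      (by linarith) (by linarith) hs.negX (by linarith) (by linarith)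
    simpa using this.negX

/-- Every point of the hull off the drawing lies in an empty box with drawn sides. -/
theorem IsTidy.exists_box (h : IsTidy G x y)
    (hcut : ∀ v a b, a ≠ v → b ≠ v → ∃ p : G.Walk a b, v ∉ p.support) {a₀ b₀ : ℝ}
    (hx : ∀ v, x v ≠ a₀) (hy : ∀ v, y v ≠ b₀)
    (hhull : ∀ s t, (∀ s' ∈ Set.uIcc a₀ s, ∀ t' ∈ Set.uIcc b₀ t, ¬ Drawn G x y s' t') →
      InHull x y s t) :
    ∃ a b c d, a < a₀ ∧ a₀ < b ∧ c < b₀ ∧ b₀ < d ∧ Undrawn G x y a b c d ∧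
      (∀ t, a ≤ t → t ≤ b → Drawn G x y t c ∧ Drawn G x y t d) ∧
      (∀ t, c ≤ t → t ≤ d → Drawn G x y a t ∧ Drawn G x y b t) := by
  have hstair : ∀ {x y : V → ℝ}, IsTidy G x y → ∀ a b, OnStair x y a b → Drawn G x y a b := by
    intro x y h a b hab
    have : Nonempty V := ⟨hab.1.ne.choose⟩
    obtain ⟨v, c, -, hc⟩ := h.exists_isCycle hcut
    obtain ⟨d, -, hbox⟩ := (hc a b).2 (.inl hab)
    exact ⟨d.fst, d.snd, d.adj, hbox⟩
  have h0 : ¬ Drawn G x y a₀ b₀ := by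
    rintro ⟨u, v, huv, h1, h2⟩
    rcases h.rectilinear u v huv with he | he
    · rw [he, Set.uIcc_self, Set.mem_singleton_iff] at h1
      exact hx v h1.symm
    · rw [he, Set.uIcc_self, Set.mem_singleton_iff] at h2
      exact hy v h2.symm
  have hin := hhull a₀ b₀ (by simpa using h0)
  obtain ⟨r₁, hr₁, -⟩ := hin.ne
  obtain ⟨l₁, hl₁, -⟩ := hin.nw
  obtain ⟨u₁, -, hu₁⟩ := hin.ne
  obtain ⟨d₁, -, hd₁⟩ := hin.se
  -- The nearest vertex coordinates on the four sides of `(a₀, b₀)` bound an initial empty box: an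
  -- edge meeting it would have a vertex coordinate strictly between them.
  obtain ⟨l₂, hl₂, hl₂'⟩ := Set.exists_max_image {v | x v < a₀} x (Set.toFinite _)
    ⟨l₁, lt_of_le_of_ne hl₁ (hx l₁)⟩
  obtain ⟨r₂, hr₂, hr₂'⟩ := Set.exists_min_image {v | a₀ < x v} x (Set.toFinite _)
    ⟨r₁, lt_of_le_of_ne hr₁ (hx r₁).symm⟩
  obtain ⟨d₂, hd₂, hd₂'⟩ := Set.exists_max_image {v | y v < b₀} y (Set.toFinite _)
    ⟨d₁, lt_of_le_of_ne hd₁ (hy d₁)⟩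
  obtain ⟨u₂, hu₂, hu₂'⟩ := Set.exists_min_image {v | b₀ < y v} y (Set.toFinite _)
    ⟨u₁, lt_of_le_of_ne hu₁ (hy u₁).symm⟩
  simp only [Set.mem_ofPred_eq] at hl₂ hl₂' hr₂ hr₂' hd₂ hd₂' hu₂ hu₂'
  have hinit : Undrawn G x y (x l₂) (x r₂) (y d₂) (y u₂) := by
    rintro s t h1 h2 h3 h4 ⟨u, v, huv, hs, ht⟩
    rcases h.rectilinear u v huv with he | he
    · rw [he, Set.uIcc_self, Set.mem_singleton_iff] at hs
      have := hl₂' v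
      have := hr₂' v
      have := hx v
      grind
    · rw [he, Set.uIcc_self, Set.mem_singleton_iff] at ht
      have := hd₂' v
      have := hu₂' v
      have := hy v
      grind
  -- Boxes are indexed by quadruples of vertices, so one of maximal half-perimeter exists; none of
  -- its sides can be pushed outwards to another vertex coordinate.
  obtain ⟨⟨l, r, d, u⟩, ⟨hl, hr, hd, hu, hfree⟩, hmax⟩ := Set.exists_max_image
    {q : V × V × V × V | x q.1 < a₀ ∧ a₀ < x q.2.1 ∧ y q.2.2.1 < b₀ ∧ b₀ < y q.2.2.2 ∧
      Undrawn G x y (x q.1) (x q.2.1) (y q.2.2.1) (y q.2.2.2)}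
    (fun q => (x q.2.1 - x q.1) + (y q.2.2.2 - y q.2.2.1)) (Set.toFinite _)
    ⟨(l₂, r₂, d₂, u₂), hl₂, hr₂, hd₂, hu₂, hinit⟩
  simp only [Set.mem_ofPred_eq, Prod.forall] at hl hr hd hu hfree hmax
  have hneg : ∀ s : ℝ, ∀ p q, s ∈ Set.uIcc p q → -s ∈ Set.uIcc (-p) (-q) := by
    intro s p q hs
    rw [Set.mem_uIcc] at hs ⊢
    grind
  have top := h.top_drawn (hstair h) hl hr hd hu hhull hfree (fun v hv => by
    by_contra! hlt
    linarith [hmax l r d v ⟨hl, hr, hd, by linarith, hv⟩])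
  have bot := h.negY.top_drawn (u := d) (a₀ := a₀) (b₀ := -b₀) (c := -y u) (hstair h.negY) hl hr
    (by linarith) (by simpa using hd)
    (fun s t hst => by
      have := hhull s (-t) fun s' hs' t' ht' hdr => hst s' hs' (-t')
        (by simpa using hneg _ _ _ ht') (drawn_negY_iff.2 (by simpa using hdr))
      simpa using this.swap.negX.swap)
    (by simpa using hfree.swap.negX.swap)
    (fun v hv => by
      have hv' : Undrawn G x y (x l) (x r) (y v) (y u) := by simpa using hv.swap.negX.swap
      simp only [Pi.neg_apply, neg_le_neg_iff]
      by_contra! hlt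
      linarith [hmax l r v u ⟨hl, hr, by linarith, hu, hv'⟩])
  have right := h.swap.top_drawn (u := r) (a₀ := b₀) (b₀ := a₀) (hstair h.swap) hd hu hl hr
    (fun s t hst => (hhull t s fun s' hs' t' ht' hdr => hst t' ht' s' hs' hdr.swap).swap)
    hfree.swap
    (fun v hv => by
      by_contra! hlt
      linarith [hmax l v d u ⟨hl, by linarith, hd, hu, hv.swap⟩])
  have left := h.rotate.top_drawn (u := l) (a₀ := b₀) (b₀ := -a₀) (c := -x r) (hstair h.rotate)
    hd hu (by linarith) (by simpa using hl)
    (fun s t hst => by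
      have := hhull (-t) s fun s' hs' t' ht' hdr => hst t' ht' (-s')
        (by simpa using hneg _ _ _ hs') (drawn_negY_iff.2 (by simpa using hdr.swap))
      simpa using this.rotate)
    (by simpa using hfree.negX.swap)
    (fun v hv => by
      have hv' : Undrawn G x y (x v) (x r) (y d) (y u) := by simpa using hv.swap.negX
      simp only [Pi.neg_apply, neg_le_neg_iff]
      by_contra! hlt
      linarith [hmax v r d u ⟨by linarith, hr, hd, hu, hv'⟩])
  refine ⟨x l, x r, y d, y u, hl, hr, hd, hu, hfree, fun t h1 h2 => ⟨?_, top t h1 h2⟩,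
    fun t h1 h2 => ⟨?_, (right t h1 h2).swap⟩⟩
  · simpa [drawn_negY_iff] using bot t h1 h2
  · exact (by simpa [drawn_negY_iff] using left t h1 h2 : Drawn G y x t (x l)).swap

end Finite

end

/-! ### Components of complements, axis-parallel segments and orthoconvexity. -/

theorem IsPreconnected.subset_of_disjoint_frontier {X : Type*} [TopologicalSpace X] {F O : Set X}
    (hF : IsPreconnected F) (hd : Disjoint F (frontier O)) (hne : (F ∩ O).Nonempty) : F ⊆ O := by
  have hsub : F ⊆ interior O ∪ (closure O)ᶜ := by
    intro z hz
    by_contra hcon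
    simp only [Set.mem_union, Set.mem_compl_iff, not_or, not_not] at hcon
    exact Set.disjoint_left.1 hd hz ⟨hcon.2, hcon.1⟩
  obtain ⟨z, hz, hzO⟩ := hne
  refine (hF.subset_left_of_subset_union isOpen_interior isClosed_closure.isOpen_compl
    ?_ hsub ⟨z, hz, ?_⟩).trans interior_subset
  · exact (disjoint_compl_right (a := closure O)).mono_left (interior_subset.trans subset_closure)
  · exact (hsub hz).resolve_right (not_not.2 (subset_closure hzO))

theorem not_isBounded_compl {O : Set ℂ} (hO : Bornology.IsBounded O) :
    ¬ Bornology.IsBounded Oᶜ := fun h =>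
  NormedSpace.unbounded_univ ℂ ℂ (by simpa using hO.union h)

/-- If `S` lies between a bounded set with connected complement and its frontier, the unbounded
component of the complement of `S` is the complement of that set, and the other components lie
inside. -/
theorem connectedComponentIn_of_frontier_subset {O S : Set ℂ} (hfr : frontier O ⊆ S)
    (hSO : S ⊆ O) (hO : Bornology.IsBounded O) (hc : IsPreconnected Oᶜ) {z : ℂ} (hz : z ∈ Sᶜ) :
    (Bornology.IsBounded (connectedComponentIn Sᶜ z) ∧ z ∈ O ∧ connectedComponentIn Sᶜ z ⊆ O) ∨
    (¬ Bornology.IsBounded (connectedComponentIn Sᶜ z) ∧ z ∉ O ∧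
      connectedComponentIn Sᶜ z = Oᶜ) := by
  have hd : Disjoint (connectedComponentIn Sᶜ z) (frontier O) :=
    Set.disjoint_left.2 fun w hw hw' => connectedComponentIn_subset _ _ hw (hfr hw')
  have hmem := mem_connectedComponentIn hz
  by_cases hzO : z ∈ O
  · have := isPreconnected_connectedComponentIn.subset_of_disjoint_frontier hd ⟨z, hmem, hzO⟩
    exact .inl ⟨hO.subset this, hzO, this⟩
  · have h1 := isPreconnected_connectedComponentIn.subset_of_disjoint_frontier
      (O := Oᶜ) (by rwa [frontier_compl]) ⟨z, hmem, hzO⟩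
    have h2 := hc.subset_connectedComponentIn (x := z) hzO (Set.compl_subset_compl.2 hSO)
    have h3 := h1.antisymm h2
    exact .inr ⟨by rw [h3]; exact not_isBounded_compl hO, hzO, h3⟩

theorem mem_segment_iff_of_axisParallel {p q z : ℂ} (h : p.re = q.re ∨ p.im = q.im) :
    z ∈ segment ℝ p q ↔ z.re ∈ Set.uIcc p.re q.re ∧ z.im ∈ Set.uIcc p.im q.im := by
  constructor
  · rintro ⟨s, t, hs, ht, hst, rfl⟩
    rw [← segment_eq_uIcc, ← segment_eq_uIcc]
    exact ⟨⟨s, t, hs, ht, hst, by simp⟩, ⟨s, t, hs, ht, hst, by simp⟩⟩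
  · rintro ⟨h1, h2⟩
    rcases h with h | h
    · rw [h, Set.uIcc_self, Set.mem_singleton_iff] at h1
      rw [← segment_eq_uIcc] at h2
      obtain ⟨s, t, hs, ht, hst, he⟩ := h2
      refine ⟨s, t, hs, ht, hst, Complex.ext ?_ (by simpa using he)⟩
      simp [h, h1, ← add_mul, hst]
    · rw [h, Set.uIcc_self, Set.mem_singleton_iff] at h2
      rw [← segment_eq_uIcc] at h1
      obtain ⟨s, t, hs, ht, hst, he⟩ := h1
      refine ⟨s, t, hs, ht, hst, Complex.ext (by simpa using he) ?_⟩
      simp [h, h2, ← add_mul, hst]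

theorem isOrthoconvex_of_isCompact {P : Set ℂ} (hP : IsCompact P)
    (hv : ∀ p q z : ℂ, p ∈ P → q ∈ P → p.re = z.re → q.re = z.re → p.im ≤ z.im → z.im ≤ q.im →
      z ∈ P)
    (hh : ∀ p q z : ℂ, p ∈ P → q ∈ P → p.im = z.im → q.im = z.im → p.re ≤ z.re → z.re ≤ q.re →
      z ∈ P) : IsOrthoconvex P := by
  constructor <;> intro a <;>
    rw [or_iff_not_imp_left, ← ne_eq, ← Set.nonempty_iff_ne_empty] <;> intro hne
  · have hcomp : IsCompact (P ∩ {z | z.re = a}) :=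
      hP.inter_right (isClosed_eq Complex.continuous_re continuous_const)
    obtain ⟨p, ⟨hp, hpa⟩, hmin⟩ := hcomp.exists_isMinOn hne Complex.continuous_im.continuousOn
    obtain ⟨q, ⟨hq, hqa⟩, hmax⟩ := hcomp.exists_isMaxOn hne Complex.continuous_im.continuousOn
    rw [Set.mem_ofPred_eq] at hpa hqa
    have hpq : p.im ≤ q.im := hmin ⟨hq, hqa⟩
    refine ⟨p, q, Set.ext fun z => ?_⟩
    rw [mem_segment_iff_of_axisParallel (.inl (hpa.trans hqa.symm)), hpa, hqa, Set.uIcc_self,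
      Set.mem_singleton_iff, Set.uIcc_of_le hpq, Set.mem_Icc]
    constructor
    · intro hz
      exact ⟨hz.2, hmin hz, hmax hz⟩
    · rintro ⟨hza, h1, h2⟩
      exact ⟨hv p q z hp hq (by rw [hpa, hza]) (by rw [hqa, hza]) h1 h2, hza⟩
  · have hcomp : IsCompact (P ∩ {z | z.im = a}) :=
      hP.inter_right (isClosed_eq Complex.continuous_im continuous_const)
    obtain ⟨p, ⟨hp, hpa⟩, hmin⟩ := hcomp.exists_isMinOn hne Complex.continuous_re.continuousOn
    obtain ⟨q, ⟨hq, hqa⟩, hmax⟩ := hcomp.exists_isMaxOn hne Complex.continuous_re.continuousOn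
    rw [Set.mem_ofPred_eq] at hpa hqa
    have hpq : p.re ≤ q.re := hmin ⟨hq, hqa⟩
    refine ⟨p, q, Set.ext fun z => ?_⟩
    rw [mem_segment_iff_of_axisParallel (.inr (hpa.trans hqa.symm)), hpa, hqa, Set.uIcc_self,
      Set.mem_singleton_iff, Set.uIcc_of_le hpq, Set.mem_Icc]
    constructor
    · intro hz
      exact ⟨⟨hmin hz, hmax hz⟩, hz.2⟩
    · rintro ⟨⟨h1, h2⟩, hza⟩
      exact ⟨hh p q z hp hq (by rw [hpa, hza]) (by rw [hqa, hza]) h1 h2, hza⟩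

/-! ### Topology of the hull. -/

section Hull

variable {V : Type*} {x y : V → ℝ}

/-- The orthogonal convex hull of the vertices. -/
def hullSet (x y : V → ℝ) : Set ℂ := {z | InHull x y z.re z.im}

theorem onFrontier_of_mem_frontier_hullSet {z : ℂ} (hz : z ∈ hullSet x y)
    (hint : z ∉ interior (hullSet x y)) : OnFrontier x y z.re z.im := by
  by_contra hcon
  simp only [OnFrontier, not_or] at hcon
  obtain ⟨h1, h2, h3, h4⟩ := hcon
  have hz' : InHull x y z.re z.im := hz
  have e1 : ∃ v, z.re < x v ∧ z.im < y v := by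
    by_contra! h
    exact h1 ⟨hz', h⟩
  have e2 : ∃ v, x v < z.re ∧ z.im < y v := by
    by_contra! h
    exact h2 ⟨hz'.rotate, fun v hv => by simpa using not_lt.1 fun hlt => not_le.2 hv (h v hlt)⟩
  have e3 : ∃ v, x v < z.re ∧ y v < z.im := by
    by_contra! h
    exact h3 ⟨hz'.rotate.rotate, by simpa using h⟩
  have e4 : ∃ v, z.re < x v ∧ y v < z.im := by
    by_contra! h
    exact h4 ⟨hz'.swap.negX, fun v hv => not_lt.1 fun hlt =>
      not_le.2 (by simpa using hv) (h v hlt)⟩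
  obtain ⟨v₁, h1, h1'⟩ := e1
  obtain ⟨v₂, h2, h2'⟩ := e2
  obtain ⟨v₃, h3, h3'⟩ := e3
  obtain ⟨v₄, h4, h4'⟩ := e4
  refine hint (mem_interior_iff_mem_nhds.2 ?_)
  have r := Complex.continuous_re.tendsto z
  have i := Complex.continuous_im.tendsto z
  filter_upwards [r.eventually (gt_mem_nhds h1), i.eventually (gt_mem_nhds h1'),
    r.eventually (lt_mem_nhds h2), i.eventually (gt_mem_nhds h2'),
    r.eventually (lt_mem_nhds h3), i.eventually (lt_mem_nhds h3'),
    r.eventually (gt_mem_nhds h4), i.eventually (lt_mem_nhds h4')] with w a1 a2 a3 a4 a5 a6 a7 a8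
  exact ⟨⟨v₁, a1.le, a2.le⟩, ⟨v₂, a3.le, a4.le⟩, ⟨v₄, a7.le, a8.le⟩, ⟨v₃, a5.le, a6.le⟩⟩

/-- A small diagonal move into the empty open quadrant leaves the hull. -/
theorem OnFrontier.notMem_interior {z : ℂ} (h : OnFrontier x y z.re z.im) :
    z ∉ interior (hullSet x y) := by
  intro hz
  have key : ∀ e : ℂ, ∃ δ : ℝ, 0 < δ ∧ InHull x y (z.re + δ * e.re) (z.im + δ * e.im) := by
    intro e
    have hcont : Tendsto (fun δ : ℝ => z + δ * e) (𝓝[>] 0) (𝓝 z) := by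
      have : Continuous fun δ : ℝ => z + δ * e := by fun_prop
      simpa using (this.tendsto 0).mono_left nhdsWithin_le_nhds
    obtain ⟨δ, hδ, hδ'⟩ := ((hcont.eventually (mem_interior_iff_mem_nhds.1 hz)).and
      self_mem_nhdsWithin).exists
    refine ⟨δ, hδ', ?_⟩
    have hδ : InHull x y (z + δ * e).re (z + δ * e).im := hδ
    simpa using hδ
  rcases h with h | h | h | h
  · obtain ⟨δ, hδ, hh⟩ := key ⟨1, 1⟩
    obtain ⟨v, hv, hv'⟩ := hh.ne
    linarith [h.2 v (by linarith)]
  · obtain ⟨δ, hδ, hh⟩ := key ⟨-1, 1⟩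
    obtain ⟨v, hv, hv'⟩ := hh.nw
    have := h.2 v (by linarith)
    simp only [Pi.neg_apply] at this
    linarith
  · obtain ⟨δ, hδ, hh⟩ := key ⟨-1, -1⟩
    obtain ⟨v, hv, hv'⟩ := hh.sw
    have := h.2 v (by simp only [Pi.neg_apply]; linarith)
    simp only [Pi.neg_apply] at this
    linarith
  · obtain ⟨δ, hδ, hh⟩ := key ⟨1, -1⟩
    obtain ⟨v, hv, hv'⟩ := hh.se
    linarith [h.2 v (by simp only [Pi.neg_apply]; linarith)]

variable [Finite V]

theorem isClosed_hullSet (x y : V → ℝ) : IsClosed (hullSet x y) := by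
  have hre := Complex.continuous_re
  have him := Complex.continuous_im
  have : hullSet x y = ((⋃ v, {z | z.re ≤ x v ∧ z.im ≤ y v}) ∩ (⋃ v, {z | x v ≤ z.re ∧ z.im ≤ y v}))
      ∩ ((⋃ v, {z | z.re ≤ x v ∧ y v ≤ z.im}) ∩ (⋃ v, {z | x v ≤ z.re ∧ y v ≤ z.im})) := by
    ext z
    simp only [Set.mem_inter_iff, Set.mem_iUnion, Set.mem_ofPred_eq, hullSet]
    exact ⟨fun h => ⟨⟨h.ne, h.nw⟩, h.se, h.sw⟩, fun h => ⟨h.1.1, h.1.2, h.2.1, h.2.2⟩⟩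
  rw [this]
  refine ((isClosed_iUnion_of_finite fun v => ?_).inter (isClosed_iUnion_of_finite fun v => ?_)).inter
    ((isClosed_iUnion_of_finite fun v => ?_).inter (isClosed_iUnion_of_finite fun v => ?_))
  · exact (isClosed_le hre continuous_const).inter (isClosed_le him continuous_const)
  · exact (isClosed_le continuous_const hre).inter (isClosed_le him continuous_const)
  · exact (isClosed_le hre continuous_const).inter (isClosed_le continuous_const him)
  · exact (isClosed_le continuous_const hre).inter (isClosed_le continuous_const him)

theorem exists_bound (x y : V → ℝ) : ∃ M, ∀ v, |x v| ≤ M ∧ |y v| ≤ M := by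
  obtain ⟨M₁, h₁⟩ := (Set.finite_range fun v => |x v|).bddAbove
  obtain ⟨M₂, h₂⟩ := (Set.finite_range fun v => |y v|).bddAbove
  exact ⟨max M₁ M₂, fun v => ⟨(h₁ ⟨v, rfl⟩).trans (le_max_left _ _),
    (h₂ ⟨v, rfl⟩).trans (le_max_right _ _)⟩⟩

theorem isBounded_hullSet (x y : V → ℝ) : Bornology.IsBounded (hullSet x y) := by
  obtain ⟨M, hM⟩ := exists_bound x y
  refine isBounded_iff_forall_norm_le.2 ⟨M + M, fun z hz => ?_⟩
  obtain ⟨v₁, h1, h1'⟩ := InHull.ne hz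
  obtain ⟨v₂, h2, h2'⟩ := InHull.sw hz
  have b1 := hM v₁
  have b2 := hM v₂
  simp only [abs_le] at b1 b2
  refine (Complex.norm_le_abs_re_add_abs_im z).trans (add_le_add ?_ ?_) <;> rw [abs_le] <;>
    constructor <;> linarith

theorem isCompact_hullSet (x y : V → ℝ) : IsCompact (hullSet x y) :=
  Metric.isCompact_of_isClosed_isBounded (isClosed_hullSet x y) (isBounded_hullSet x y)

theorem mem_frontier_hullSet_iff {z : ℂ} :
    z ∈ frontier (hullSet x y) ↔ OnFrontier x y z.re z.im := by
  rw [(isClosed_hullSet x y).frontier_eq]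
  refine ⟨fun h => onFrontier_of_mem_frontier_hullSet h.1 h.2, fun h => ⟨?_, h.notMem_interior⟩⟩
  rcases h with h | h | h | h
  · exact h.1
  · have := h.1.swap.negX
    simp only [neg_neg] at this
    exact this
  · have := h.1.rotate.rotate
    simp only [neg_neg] at this
    exact this
  · have := h.1.rotate
    simp only [neg_neg] at this
    exact this

/-- At a point outside the hull, some closed quadrant contains no vertex. This quadrant is convex,
avoids the hull and reaches the exterior `U` of a large square, which is connected. -/
theorem isPreconnected_compl_hullSet (x y : V → ℝ) : IsPreconnected (hullSet x y)ᶜ := by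
  obtain ⟨M, hM⟩ := exists_bound x y
  have hM' : ∀ v, (-M ≤ x v ∧ x v ≤ M) ∧ (-M ≤ y v ∧ y v ≤ M) := fun v => by
    simpa only [abs_le] using hM v
  have cR := (convex_halfSpace_re_gt (|M| + 1)).isPreconnected
  have cL := (convex_halfSpace_re_lt (-(|M| + 1))).isPreconnected
  have cT := (convex_halfSpace_im_gt (|M| + 1)).isPreconnected
  have cB := (convex_halfSpace_im_lt (-(|M| + 1))).isPreconnected
  have hMM := le_abs_self M
  have hMM' := neg_abs_le M
  have hM0 := abs_nonneg M
  set U : Set ℂ := (({z | |M| + 1 < z.re} ∪ {z | |M| + 1 < z.im}) ∪ {z | z.re < -(|M| + 1)}) ∪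
    {z | z.im < -(|M| + 1)} with hU
  have cU : IsPreconnected U := by
    refine ((cR.union' ⟨⟨|M| + 2, |M| + 2⟩, ?_⟩ cT).union' ⟨⟨-(|M| + 2), |M| + 2⟩, ?_⟩ cL).union'
      ⟨⟨-(|M| + 2), -(|M| + 2)⟩, ?_⟩ cB
    · constructor <;> simp only [Set.mem_ofPred_eq] <;> linarith
    · refine ⟨.inr ?_, ?_⟩ <;> simp only [Set.mem_ofPred_eq] <;> linarith
    · refine ⟨.inr ?_, ?_⟩ <;> simp only [Set.mem_ofPred_eq] <;> linarith
  have hUO : U ⊆ (hullSet x y)ᶜ := by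
    intro z hz hzO
    obtain ⟨v₁, h1, h1'⟩ := InHull.ne hzO
    obtain ⟨v₂, h2, h2'⟩ := InHull.sw hzO
    have b1 := hM' v₁
    have b2 := hM' v₂
    simp only [hU, Set.mem_union, Set.mem_ofPred_eq] at hz
    rcases hz with ((hz | hz) | hz) | hz <;> linarith
  refine isPreconnected_of_forall (⟨|M| + 2, 0⟩ : ℂ) fun z hz => ?_
  have hpt : (⟨|M| + 2, 0⟩ : ℂ) ∈ U := .inl (.inl (.inl (by
    simp only [Set.mem_ofPred_eq]; linarith)))
  suffices hQ : ∃ Q : Set ℂ, Convex ℝ Q ∧ Q ⊆ (hullSet x y)ᶜ ∧ z ∈ Q ∧ (Q ∩ U).Nonempty by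
    obtain ⟨Q, cQ, hQO, hzQ, hQU⟩ := hQ
    exact ⟨Q ∪ U, Set.union_subset hQO hUO, .inr hpt, .inl hzQ, cQ.isPreconnected.union' hQU cU⟩
  have hza := le_abs_self z.re
  have hza' := neg_abs_le z.re
  have hz0 := abs_nonneg z.re
  by_cases e1 : ∃ v, z.re ≤ x v ∧ z.im ≤ y v
  · by_cases e2 : ∃ v, x v ≤ z.re ∧ z.im ≤ y v
    · by_cases e3 : ∃ v, z.re ≤ x v ∧ y v ≤ z.im
      · have e4 : ¬ ∃ v, x v ≤ z.re ∧ y v ≤ z.im := fun e4 => hz ⟨e1, e2, e3, e4⟩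
        refine ⟨{w | w.re ≤ z.re} ∩ {w | w.im ≤ z.im},
          (convex_halfSpace_re_le _).inter (convex_halfSpace_im_le _), fun w hw hwO => ?_,
          ⟨le_refl z.re, le_refl z.im⟩, ⟨-(|M| + 2) - |z.re|, z.im⟩, ⟨?_, le_refl z.im⟩, .inl (.inr ?_)⟩
        · obtain ⟨v, hv, hv'⟩ := InHull.sw hwO
          exact e4 ⟨v, hv.trans hw.1, hv'.trans hw.2⟩
        all_goals simp only [Set.mem_ofPred_eq]; linarith
      · refine ⟨{w | z.re ≤ w.re} ∩ {w | w.im ≤ z.im},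
          (convex_halfSpace_re_ge _).inter (convex_halfSpace_im_le _), fun w hw hwO => ?_,
          ⟨le_refl z.re, le_refl z.im⟩, ⟨(|M| + 2) + |z.re|, z.im⟩, ⟨?_, le_refl z.im⟩, .inl (.inl (.inl ?_))⟩
        · obtain ⟨v, hv, hv'⟩ := InHull.se hwO
          exact e3 ⟨v, hw.1.trans hv, hv'.trans hw.2⟩
        all_goals simp only [Set.mem_ofPred_eq]; linarith
    · refine ⟨{w | w.re ≤ z.re} ∩ {w | z.im ≤ w.im},
        (convex_halfSpace_re_le _).inter (convex_halfSpace_im_ge _), fun w hw hwO => ?_,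
        ⟨le_refl z.re, le_refl z.im⟩, ⟨-(|M| + 2) - |z.re|, z.im⟩, ⟨?_, le_refl z.im⟩, .inl (.inr ?_)⟩
      · obtain ⟨v, hv, hv'⟩ := InHull.nw hwO
        exact e2 ⟨v, hv.trans hw.1, hw.2.trans hv'⟩
      all_goals simp only [Set.mem_ofPred_eq]; linarith
  · refine ⟨{w | z.re ≤ w.re} ∩ {w | z.im ≤ w.im},
      (convex_halfSpace_re_ge _).inter (convex_halfSpace_im_ge _), fun w hw hwO => ?_,
      ⟨le_refl z.re, le_refl z.im⟩, ⟨(|M| + 2) + |z.re|, z.im⟩, ⟨?_, le_refl z.im⟩, .inl (.inl (.inl ?_))⟩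
    · obtain ⟨v, hv, hv'⟩ := InHull.ne hwO
      exact e1 ⟨v, hw.1.trans hv, hw.2.trans hv'⟩
    all_goals simp only [Set.mem_ofPred_eq]; linarith

theorem isOrthoconvex_hullSet (x y : V → ℝ) : IsOrthoconvex (hullSet x y) := by
  refine isOrthoconvex_of_isCompact (isCompact_hullSet x y) ?_ ?_
  · intro p q z hp hq hpz hqz h1 h2
    obtain ⟨v₁, a1, b1⟩ := InHull.ne hq
    obtain ⟨v₂, a2, b2⟩ := InHull.nw hq
    obtain ⟨v₃, a3, b3⟩ := InHull.se hp
    obtain ⟨v₄, a4, b4⟩ := InHull.sw hp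
    refine ⟨⟨v₁, ?_, ?_⟩, ⟨v₂, ?_, ?_⟩, ⟨v₃, ?_, ?_⟩, ⟨v₄, ?_, ?_⟩⟩ <;> linarith
  · intro p q z hp hq hpz hqz h1 h2
    obtain ⟨v₁, a1, b1⟩ := InHull.ne hq
    obtain ⟨v₂, a2, b2⟩ := InHull.nw hp
    obtain ⟨v₃, a3, b3⟩ := InHull.se hq
    obtain ⟨v₄, a4, b4⟩ := InHull.sw hp
    refine ⟨⟨v₁, ?_, ?_⟩, ⟨v₂, ?_, ?_⟩, ⟨v₃, ?_, ?_⟩, ⟨v₄, ?_, ?_⟩⟩ <;> linarith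

theorem closedRegion_frontier_hullSet (x y : V → ℝ) :
    closedRegion (frontier (hullSet x y)) = hullSet x y := by
  have hsub : frontier (hullSet x y) ⊆ hullSet x y := (isClosed_hullSet x y).frontier_subset
  ext z
  by_cases hz : z ∈ frontier (hullSet x y)
  · exact ⟨fun _ => hsub hz, fun _ => .inl hz⟩
  · rcases connectedComponentIn_of_frontier_subset subset_rfl hsub (isBounded_hullSet x y)
      (isPreconnected_compl_hullSet x y) hz with ⟨h1, h2, -⟩ | ⟨h1, h2, -⟩
    · exact ⟨fun _ => h2, fun _ => .inr ⟨hz, h1⟩⟩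
    · refine ⟨fun h => ?_, fun h => absurd h h2⟩
      rcases h with h | h
      · exact absurd h hz
      · exact absurd h.2 h1

end Hull

/-! ### Tidy drawings are convex. -/

section

variable {V : Type*} {G : SimpleGraph V}

theorem convex_reProdIm {s t : Set ℝ} (hs : Convex ℝ s) (ht : Convex ℝ t) :
    Convex ℝ (s ×ℂ t) :=
  (hs.linear_preimage Complex.reLm).inter (ht.linear_preimage Complex.imLm)

theorem IsBiconnected.exists_walk_notMem (hG : IsBiconnected G) (v a b : V) (ha : a ≠ v)
    (hb : b ≠ v) : ∃ p : G.Walk a b, v ∉ p.support := by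
  by_cases hab : a = b
  · subst hab
    exact ⟨.nil, by simpa using ha.symm⟩
  · obtain ⟨p, q, -, -, -, hpq⟩ := hG.2 a b hab
    by_cases hp : v ∈ p.support
    · refine ⟨q, fun hq => ?_⟩
      rcases hpq v hp hq with h | h
      · exact ha h.symm
      · exact hb h.symm
    · exact ⟨p, hp⟩

theorem IsBiconnected.exists_walk (hG : IsBiconnected G) (a b : V) : Nonempty (G.Walk a b) := by
  by_cases hab : a = b
  · subst hab
    exact ⟨.nil⟩
  · obtain ⟨p, -⟩ := hG.2 a b hab
    exact ⟨p⟩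

theorem IsBiconnected.two_neighbors (hG : IsBiconnected G) (v : V) :
    ∃ u w, u ≠ w ∧ G.Adj v u ∧ G.Adj v w := by
  have := hG.1
  obtain ⟨t, ht⟩ := exists_ne v
  obtain ⟨p, q, hp, hq, hne, hpq⟩ := hG.2 v t ht.symm
  cases p with
  | nil => exact absurd rfl ht
  | @cons _ m _ hm p =>
    cases q with
    | nil => exact absurd rfl ht
    | @cons _ n _ hn q =>
      refine ⟨m, n, fun hmn => ?_, hm, hn⟩
      subst hmn
      rcases hpq m (by simp) (by simp) with h | h
      · exact hm.ne h.symm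
      · subst h
        rw [SimpleGraph.Walk.cons_isPath_iff, SimpleGraph.Walk.isPath_iff_nil] at hp hq
        exact hne (by rw [hp.1.eq_nil, hq.1.eq_nil])

namespace RectilinearDrawing

/-- The abscissas of the vertices. -/
def xs (Γ : RectilinearDrawing G) (v : V) : ℝ := (Γ.pos v).re

/-- The ordinates of the vertices. -/
def ys (Γ : RectilinearDrawing G) (v : V) : ℝ := (Γ.pos v).im

theorem mem_segment_iff (Γ : RectilinearDrawing G) {u v : V} (huv : G.Adj u v) {z : ℂ} :
    z ∈ segment ℝ (Γ.pos u) (Γ.pos v) ↔ InBox Γ.xs Γ.ys u v z.re z.im :=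
  mem_segment_iff_of_axisParallel (Γ.rectilinear u v huv)

theorem isGrid (Γ : RectilinearDrawing G) (h2 : ∀ v, ∃ u w, u ≠ w ∧ G.Adj v u ∧ G.Adj v w) :
    IsGrid G Γ.xs Γ.ys where
  injective u v hx hy := Γ.pos_injective (Complex.ext hx hy)
  rectilinear := Γ.rectilinear
  planar u v u' v' huv huv' hne a b hab hab' := by
    obtain ⟨w, h1, h2, h3⟩ := Γ.planar u v u' v' huv huv' hne ⟨a, b⟩
      ((Γ.mem_segment_iff huv).2 hab) ((Γ.mem_segment_iff huv').2 hab')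
    exact ⟨w, h1, h2, congrArg Complex.re h3, congrArg Complex.im h3⟩
  two_neighbors := h2

theorem mem_image_iff (Γ : RectilinearDrawing G) (h : IsGrid G Γ.xs Γ.ys) {z : ℂ} :
    z ∈ Γ.image ↔ Drawn G Γ.xs Γ.ys z.re z.im := by
  constructor
  · rintro (⟨v, rfl⟩ | ⟨u, v, huv, hz⟩)
    · exact h.drawn_vertex v
    · exact ⟨u, v, huv, (Γ.mem_segment_iff huv).1 hz⟩
  · rintro ⟨u, v, huv, hz⟩
    exact .inr ⟨u, v, huv, (Γ.mem_segment_iff huv).2 hz⟩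

theorem mem_curve_iff (Γ : RectilinearDrawing G) {v : V} (c : G.Walk v v) {z : ℂ} :
    z ∈ Γ.curve c ↔ ∃ d ∈ c.darts, InBox Γ.xs Γ.ys d.fst d.snd z.re z.im := by
  constructor
  · rintro ⟨a, b, hab, hz⟩
    obtain ⟨d, hd, he⟩ := List.mem_map.1 hab
    refine ⟨d, hd, (Γ.mem_segment_iff d.adj).1 ?_⟩
    rcases SimpleGraph.dart_edge_eq_mk'_iff'.1 he with ⟨rfl, rfl⟩ | ⟨rfl, rfl⟩
    · exact hz
    · rwa [segment_symm]
  · rintro ⟨d, hd, hz⟩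
    exact ⟨d.fst, d.snd, List.mem_map.2 ⟨d, hd, rfl⟩, (Γ.mem_segment_iff d.adj).2 hz⟩

section Finite

variable [Finite V]

theorem isClosed_image (Γ : RectilinearDrawing G) : IsClosed Γ.image := by
  refine (Set.finite_range _).isClosed.union ?_
  have : {z | ∃ u v, G.Adj u v ∧ z ∈ segment ℝ (Γ.pos u) (Γ.pos v)} =
      ⋃ u, ⋃ v, ⋃ _ : G.Adj u v, segment ℝ (Γ.pos u) (Γ.pos v) := by
    ext z
    simp
  rw [this]
  refine isClosed_iUnion_of_finite fun u => isClosed_iUnion_of_finite fun v =>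
    isClosed_iUnion_of_finite fun _ => ?_
  rw [← convexHull_pair]
  exact (Set.toFinite _).isClosed_convexHull _

/-- A tidy drawing of a biconnected graph has rectangular internal faces and an orthoconvex outer
boundary. -/
theorem convex_of_isTidy (Γ : RectilinearDrawing G) (hG : IsBiconnected G)
    (h : IsTidy G Γ.xs Γ.ys) : Γ.InternalFacesRectangular ∧ Γ.OuterBoundaryOrthoconvex := by
  have : Nonempty V := hG.1.to_nonempty
  obtain ⟨v, c, hc, hcurve⟩ := h.exists_isCycle hG.exists_walk_notMem
  set O := hullSet Γ.xs Γ.ys with hO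
  have hfr : frontier O = Γ.curve c := by
    ext z
    rw [mem_frontier_hullSet_iff, Γ.mem_curve_iff, hcurve]
  have hfrS : frontier O ⊆ Γ.image := by
    rw [hfr]
    rintro z ⟨a, b, hab, hz⟩
    exact .inr ⟨a, b, c.adj_of_mem_edges hab, hz⟩
  have hSO : Γ.image ⊆ O := by
    intro z hz
    obtain ⟨a, b, hab, hz⟩ := (Γ.mem_image_iff h.toIsGrid).1 hz
    exact h.inHull_of_inBox hab hz
  have hcomp := fun z hz => connectedComponentIn_of_frontier_subset (z := z) hfrS hSO
    (isBounded_hullSet _ _) (isPreconnected_compl_hullSet _ _) hz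
  constructor
  · rintro F ⟨⟨z, hz, rfl⟩, hb⟩
    obtain ⟨-, -, hFO⟩ := (hcomp z hz).resolve_right fun h => h.1 hb
    have hopen : IsOpen (connectedComponentIn Γ.imageᶜ z) :=
      Γ.isClosed_image.isOpen_compl.connectedComponentIn
    -- The base point is moved diagonally within its open face, off the finitely many abscissas and
    -- ordinates of vertices, as `IsTidy.exists_box` requires.
    obtain ⟨δ, hδF, hδx, hδy⟩ : ∃ δ : ℝ, z + δ * (1 + Complex.I) ∈ connectedComponentIn Γ.imageᶜ z ∧
        (∀ v, Γ.xs v ≠ z.re + δ) ∧ (∀ v, Γ.ys v ≠ z.im + δ) := by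
      have hcont : Continuous fun δ : ℝ => z + δ * (1 + Complex.I) := by fun_prop
      have hnear : ∀ᶠ δ : ℝ in 𝓝 0, z + δ * (1 + Complex.I) ∈ connectedComponentIn Γ.imageᶜ z :=
        hcont.continuousAt.eventually (by simpa using hopen.mem_nhds (mem_connectedComponentIn hz))
      obtain ⟨ε, hε, hball⟩ := Metric.eventually_nhds_iff.1 hnear
      obtain ⟨δ, hδ, hδ'⟩ := (Set.Ioo_infinite hε).exists_notMem_finite
        ((Set.finite_range fun v => Γ.xs v - z.re).union (Set.finite_range fun v => Γ.ys v - z.im))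
      refine ⟨δ, hball ?_, fun v hv => hδ' (.inl ⟨v, ?_⟩), fun v hv => hδ' (.inr ⟨v, ?_⟩)⟩
      · rw [Real.dist_eq, sub_zero, abs_of_pos hδ.1]
        exact hδ.2
      · simp only [hv]; ring
      · simp only [hv]; ring
    set w := z + δ * (1 + Complex.I) with hw
    have hwre : w.re = z.re + δ := by simp [hw]
    have hwim : w.im = z.im + δ := by simp [hw]
    rw [← hwre] at hδx
    rw [← hwim] at hδy
    have hF : connectedComponentIn Γ.imageᶜ z = connectedComponentIn Γ.imageᶜ w :=
      connectedComponentIn_eq hδF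
    rw [hF] at hFO ⊢
    have hwS : w ∈ Γ.imageᶜ := connectedComponentIn_subset _ _ hδF
    -- A closed box with opposite corners `w` and `(s, t)` that avoids the drawing is connected, so
    -- it stays in the face of `w`, which lies in the hull.
    obtain ⟨a, b, c', d, ha, hb', hc', hd, hfree, hside, hside'⟩ :=
      h.exists_box hG.exists_walk_notMem hδx hδy fun s t hst => by
        have hconv : Convex ℝ (Set.uIcc w.re s ×ℂ Set.uIcc w.im t) :=
          convex_reProdIm (convex_uIcc _ _) (convex_uIcc _ _)
        have hsub := hconv.isPreconnected.subset_connectedComponentIn (x := w)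
          (F := Γ.imageᶜ) ⟨Set.left_mem_uIcc, Set.left_mem_uIcc⟩ fun p hp hpS =>
            hst p.re hp.1 p.im hp.2 ((Γ.mem_image_iff h.toIsGrid).1 hpS)
        exact hFO (hsub (a := ⟨s, t⟩) ⟨Set.right_mem_uIcc, Set.right_mem_uIcc⟩)
    refine ⟨a, b, c', d, by linarith, by linarith, ?_⟩
    have hR : {z : ℂ | a < z.re ∧ z.re < b ∧ c' < z.im ∧ z.im < d} =
        Set.Ioo a b ×ℂ Set.Ioo c' d := by
      ext p
      simp only [Complex.mem_reProdIm, Set.mem_Ioo, Set.mem_ofPred_eq, and_assoc]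
    rw [hR]
    have hwR : w ∈ Set.Ioo a b ×ℂ Set.Ioo c' d := ⟨⟨ha, hb'⟩, hc', hd⟩
    -- The drawn sides keep the face inside the box; the open box is convex and undrawn, so it lies
    -- in a single face.
    refine Set.Subset.antisymm ?_ ?_
    · refine isPreconnected_connectedComponentIn.subset_of_disjoint_frontier ?_
        ⟨w, mem_connectedComponentIn hwS, hwR⟩
      refine Set.disjoint_left.2 fun p hp hpR =>
        connectedComponentIn_subset _ _ hp ((Γ.mem_image_iff h.toIsGrid).2 ?_)
      rw [Complex.frontier_reProdIm, closure_Ioo (by linarith), closure_Ioo (by linarith),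
        frontier_Ioo (by linarith), frontier_Ioo (by linarith)] at hpR
      rcases hpR with ⟨h1, h2 | h2⟩ | ⟨h1 | h1, h2⟩
      · have h2 : p.im = c' := h2
        rw [h2]
        exact (hside p.re h1.1 h1.2).1
      · have h2 : p.im = d := h2
        rw [h2]
        exact (hside p.re h1.1 h1.2).2
      · have h1 : p.re = a := h1
        rw [h1]
        exact (hside' p.im h2.1 h2.2).1
      · have h1 : p.re = b := h1
        rw [h1]
        exact (hside' p.im h2.1 h2.2).2
    · refine (convex_reProdIm (convex_Ioo a b) (convex_Ioo c' d)).isPreconnected.subset_connectedComponentIn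
        hwR fun p hp hpS => ?_
      exact hfree p.re p.im hp.1.1 hp.1.2 hp.2.1 hp.2.2 ((Γ.mem_image_iff h.toIsGrid).1 hpS)
  · rintro F ⟨⟨z, hz, rfl⟩, hb⟩
    obtain ⟨-, -, hF⟩ := (hcomp z hz).resolve_left fun h => hb h.1
    refine ⟨v, c, hc, ?_, ?_⟩
    · rw [hF, frontier_compl, hfr]
    · rw [← hfr, closedRegion_frontier_hullSet]
      exact isOrthoconvex_hullSet _ _

end Finite

/-! ### From angles to edge directions; greedy drawings are tidy. -/

theorem pos_sub_ne_zero (Γ : RectilinearDrawing G) {u v : V} (h : G.Adj u v) :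
    Γ.pos v - Γ.pos u ≠ 0 :=
  sub_ne_zero.2 fun he => h.ne (Γ.pos_injective he).symm

/-- If the angles agree, so do the directions of the edges up to a common rotation. -/
theorem SameAngles.exists_rotation {Γ Γ' : RectilinearDrawing G} (h : Γ.SameAngles Γ')
    (hG : IsBiconnected G) : ∃ κ : ℂ, κ ≠ 0 ∧ ∀ u v, G.Adj u v →
      ∃ r : ℝ, 0 < r ∧ Γ'.pos v - Γ'.pos u = r * (κ * (Γ.pos v - Γ.pos u)) := by
  -- Once one edge at `v` is turned by `κ` up to a positive factor, equality of the angles at `v`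
  -- does the same for every other edge at `v`.
  have turn : ∀ (κ : ℂ) (v u w : V), G.Adj v u → G.Adj v w →
      (∃ r : ℝ, 0 < r ∧ Γ'.pos u - Γ'.pos v = r * (κ * (Γ.pos u - Γ.pos v))) →
      ∃ r : ℝ, 0 < r ∧ Γ'.pos w - Γ'.pos v = r * (κ * (Γ.pos w - Γ.pos v)) := by
    rintro κ v u w hu hw ⟨r, hr, he⟩
    have hu0 := Γ.pos_sub_ne_zero hu
    have hu0' := Γ'.pos_sub_ne_zero hu
    have hA := div_ne_zero (Γ.pos_sub_ne_zero hw) hu0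
    have hA' := div_ne_zero (Γ'.pos_sub_ne_zero hw) hu0'
    have harg := (Complex.arg_eq_arg_iff hA hA').1 (h u v w hu hw)
    set s : ℝ := ‖(Γ'.pos w - Γ'.pos v) / (Γ'.pos u - Γ'.pos v)‖ /
      ‖(Γ.pos w - Γ.pos v) / (Γ.pos u - Γ.pos v)‖ with hs
    have hs0 : 0 < s := div_pos (norm_pos_iff.2 hA') (norm_pos_iff.2 hA)
    rw [← Complex.ofReal_div, ← hs, eq_div_iff hu0', he] at harg
    refine ⟨s * r, mul_pos hs0 hr, ?_⟩
    rw [← harg]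
    push_cast
    field_simp
  have := hG.1
  obtain ⟨v₀⟩ := hG.1.to_nonempty
  obtain ⟨u₀, -, -, hu₀, -⟩ := hG.two_neighbors v₀
  have n := Γ.pos_sub_ne_zero hu₀
  have n' := Γ'.pos_sub_ne_zero hu₀
  -- The factor `κ` is read off from one reference edge at `v₀` and carried along a walk; reversing
  -- an edge changes the sign on both sides.
  refine ⟨(Γ'.pos u₀ - Γ'.pos v₀) / (Γ.pos u₀ - Γ.pos v₀), div_ne_zero n' n, fun u => ?_⟩
  obtain ⟨p⟩ := hG.exists_walk u v₀
  induction p with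
  | nil =>
    exact fun w hw => turn _ _ u₀ w hu₀ hw ⟨1, one_pos, by field_simp; simp⟩
  | @cons u m _ hm p ih =>
    intro w hw
    obtain ⟨r, hr, he⟩ := ih hu₀ n n' u hm.symm
    refine turn _ u m w hm hw ⟨r, hr, ?_⟩
    linear_combination -he

/-- The drawing multiplied by a complex number that keeps the edges parallel to the axes. -/
def scale (Γ : RectilinearDrawing G) (κ : ℂ) (hκ : κ ≠ 0) (hr : ∀ u v, G.Adj u v →
    (κ * Γ.pos u).re = (κ * Γ.pos v).re ∨ (κ * Γ.pos u).im = (κ * Γ.pos v).im) :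
    RectilinearDrawing G where
  pos v := κ * Γ.pos v
  pos_injective u v h := Γ.pos_injective (mul_left_cancel₀ hκ h)
  rectilinear := hr
  planar u v u' v' huv huv' hne z hz hz' := by
    have key : ∀ a b : ℂ, z ∈ segment ℝ (κ * a) (κ * b) → κ⁻¹ * z ∈ segment ℝ a b := by
      rintro a b ⟨s, t, hs, ht, hst, rfl⟩
      refine ⟨s, t, hs, ht, hst, ?_⟩
      simp only [Complex.real_smul]
      field_simp
    obtain ⟨w, h1, h2, h3⟩ := Γ.planar u v u' v' huv huv' hne _ (key _ _ hz) (key _ _ hz')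
    exact ⟨w, h1, h2, by rw [← h3, mul_inv_cancel_left₀ hκ]⟩

theorem IsGreedy.exists_closer {Γ : RectilinearDrawing G} (h : Γ.IsGreedy) {v w : V}
    (hne : v ≠ w) :
    ∃ u, G.Adj v u ∧ dist (Γ.pos u) (Γ.pos w) < dist (Γ.pos v) (Γ.pos w) := by
  obtain ⟨p, -, hp⟩ := h v w
  cases p with
  | nil => exact absurd rfl hne
  | @cons _ m _ hm p => exact ⟨m, hm, by simpa using hp 0 (by simp)⟩

/-- Multiplication by `κ` scales all distances by `‖κ‖`, so closer neighbours remain closer. The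
scaled drawing serves to align the edge directions exactly with those of another drawing. -/
theorem IsGreedy.isTidy_scale {Γ : RectilinearDrawing G} (h : Γ.IsGreedy)
    (hG : IsBiconnected G) (κ : ℂ) (hκ : κ ≠ 0) (hr : ∀ u v, G.Adj u v →
    (κ * Γ.pos u).re = (κ * Γ.pos v).re ∨ (κ * Γ.pos u).im = (κ * Γ.pos v).im) :
    IsTidy G (Γ.scale κ hκ hr).xs (Γ.scale κ hκ hr).ys := by
  refine ((Γ.scale κ hκ hr).isGrid hG.two_neighbors).isTidy_of_closer fun v w hne => ?_
  obtain ⟨u, hu, hlt⟩ := h.exists_closer hne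
  refine ⟨u, hu, ?_⟩
  have key : ∀ v, ((Γ.scale κ hκ hr).xs v - (Γ.scale κ hκ hr).xs w) ^ 2 +
      ((Γ.scale κ hκ hr).ys v - (Γ.scale κ hκ hr).ys w) ^ 2 =
      (‖κ‖ * dist (Γ.pos v) (Γ.pos w)) ^ 2 := by
    intro v
    rw [Complex.dist_eq, ← norm_mul, ← Complex.normSq_eq_norm_sq, Complex.normSq_apply, mul_sub]
    simp only [xs, ys, scale, Complex.sub_re, Complex.sub_im]
    ring
  rw [key, key]
  have := norm_pos_iff.2 hκ
  gcongr

end RectilinearDrawing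

end

theorem mainTheorem10 {V : Type*} [Finite V] (G : SimpleGraph V) (hG : IsBiconnected G)
    (H : RectilinearRepresentation G) (hH : H.GreedyRealizable) : H.IsConvex := by
  obtain ⟨Γ, hΓ, hgreedy⟩ := hH
  intro Γ' hΓ'
  have hshape : Γ.ShapeEquivalent Γ' := Quotient.exact (hΓ.trans hΓ'.symm)
  obtain ⟨κ, hκ, hdir⟩ := hshape.2.exists_rotation hG
  have hcoord : ∀ u v, G.Adj u v → ∃ r : ℝ, 0 < r ∧
      (Γ'.pos v).re - (Γ'.pos u).re = r * ((κ * Γ.pos v).re - (κ * Γ.pos u).re) ∧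
      (Γ'.pos v).im - (Γ'.pos u).im = r * ((κ * Γ.pos v).im - (κ * Γ.pos u).im) := by
    intro u v huv
    obtain ⟨r, hr, he⟩ := hdir u v huv
    rw [mul_sub] at he
    refine ⟨r, hr, ?_, ?_⟩
    · simpa only [Complex.sub_re, Complex.re_ofReal_mul] using congrArg Complex.re he
    · simpa only [Complex.sub_im, Complex.im_ofReal_mul] using congrArg Complex.im he
  -- The scaled greedy drawing is axis-parallel because its edges are positive multiples of those of
  -- `Γ'`.
  have hrect : ∀ u v, G.Adj u v →
      (κ * Γ.pos u).re = (κ * Γ.pos v).re ∨ (κ * Γ.pos u).im = (κ * Γ.pos v).im := by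
    intro u v huv
    obtain ⟨r, hr, hx, hy⟩ := hcoord u v huv
    rcases Γ'.rectilinear u v huv with he | he
    · rw [he, sub_self, eq_comm, mul_eq_zero] at hx
      exact .inl (sub_eq_zero.1 (hx.resolve_left hr.ne')).symm
    · rw [he, sub_self, eq_comm, mul_eq_zero] at hy
      exact .inr (sub_eq_zero.1 (hy.resolve_left hr.ne')).symm
  refine Γ'.convex_of_isTidy hG ((hgreedy.isTidy_scale hG κ hκ hrect).of_lt_iff
    (Γ'.isGrid hG.two_neighbors) (fun u v huv => ?_) fun u v huv => ?_)
  · obtain ⟨r, hr, hx, -⟩ := hcoord u v huv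
    change (κ * Γ.pos u).re < (κ * Γ.pos v).re ↔ (Γ'.pos u).re < (Γ'.pos v).re
    rw [← sub_pos, ← sub_pos (b := (Γ'.pos u).re), hx, mul_pos_iff_of_pos_left hr]
  · obtain ⟨r, hr, -, hy⟩ := hcoord u v huv
    change (κ * Γ.pos u).im < (κ * Γ.pos v).im ↔ (Γ'.pos u).im < (Γ'.pos v).im
    rw [← sub_pos, ← sub_pos (b := (Γ'.pos u).im), hy, mul_pos_iff_of_pos_left hr]
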